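/- Let $k\ge 0$ be an integer and let $\mathcal C$ be a class of finite matroids that is $k$-locked: there is a constant $c$ such that $\ell(M)\le c\,|E(M)|^k$ for all $M\in\mathcal C$, where $\ell(M)$ is the number of locked subsets of $M$. Here a subset $L$ of the ground set $E$ of a 2-connected matroid $M$ is locked if $M|L$ and $M^*|(E\setminus L)$ are 2-connected, $r(L)\ge 2$ and $r^*(E\setminus L)\ge 2$. The locked subsets of a matroid that is not 2-connected are those of its 2-connected components. Let $\mathrm{MIP}(\mathcal C)$ be the following decision problem. Given two matroids $M_1,M_2\in\mathcal C$, is there a bijection $\varphi:E(M_1)\to E(M_2)$ such that, for all $B\subseteq E(M_1)$, $B$ is a base of $M_1$ if and only if $\varphi(B)$ is a base of $M_2$? Each matroid is given by its locked structure, that is, by the list, in any order, of its parallel closures, its coparallel closures, its locked subsets and its 2-connected components (for a 2-connected matroid only $E$ itself), each with its rank. Sets are written as characteristic vectors on the ground set $\{0,\dots,n-1\}$. Then $\mathrm{MIP}(\mathcal C)$ is polynomial-time many-one reducible to the isomorphism problem for (unlabelled) acyclic directed graphs, and it is polynomial-time many-one reducible to the graph isomorphism problem. In both cases the running time of the reduction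 is bounded by a polynomial in $|E(M_1)|+|E(M_2)|$; in particular the graphs that it produces have polynomial size in $|E(M_1)|+|E(M_2)|$. -/

import Mathlib

open scoped Matroid

/-! ### Decision problems and polynomial-time many-one reductions -/

/-- A decision problem: its instances, their encodings as words over a finite alphabet, and its
yes-instances. `size` is the parameter of an instance in which running times are measured. It never
exceeds the length of the encoding, so that a running time that is polynomial in `size` is also
polynomial in the length of the input. -/
structure DecisionProblem where
  Instance : Type
  Alphabet : Type
  [finiteAlphabet : Finite Alphabet]
  encode : Instance → List Alphabet
  size : Instance → ℕ
  size_le : ∀ x, size x ≤ (encode x).length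
  yes : Set Instance

/-- Polynomial-time many-one (Karp) reducibility: a Turing machine (Mathlib's multi-stack machine
`Turing.FinTM2`) that, started with the encoding of an instance `x` of `A`, halts within `p (size x)`
steps with the encoding of an instance `f x` of `B` as its output, where `p` is a polynomial, and
`f x` is a yes-instance exactly when `x` is one. -/
def PolyTimeReducible (A B : DecisionProblem) : Prop :=
  ∃ (f : A.Instance → B.Instance)
    (T : Turing.TM2ComputableAux A.Alphabet B.Alphabet) (p : Polynomial ℕ),
    (∀ x, Nonempty (Turing.TM2OutputsInTime T.tm
      ((A.encode x).map T.inputAlphabet.symm)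
      (some ((B.encode (f x)).map T.outputAlphabet.symm))
      (p.eval (A.size x)))) ∧
    ∀ x, x ∈ A.yes ↔ f x ∈ B.yes

/-! ### Graph isomorphism and acyclic digraph isomorphism -/

/-- A list of pairs of vertices from `{0, …, m - 1}`. -/
structure ArcList where
  m : ℕ
  arcs : List (Fin m × Fin m)

/-- The directed graph with the listed arcs. -/
def ArcList.toDigraph (A : ArcList) : Digraph (Fin A.m) where
  Adj u v := (u, v) ∈ A.arcs

/-- The simple undirected graph with the listed edges: the order of the two ends of an edge is
immaterial, and pairs of equal vertices are ignored. -/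
def ArcList.toGraph (A : ArcList) : SimpleGraph (Fin A.m) :=
  SimpleGraph.fromRel fun u v => (u, v) ∈ A.arcs

/-- A directed graph is acyclic if it has no closed directed walk of positive length. -/
def Digraph.IsAcyclic {V : Type*} (D : Digraph V) : Prop :=
  ∀ v, ¬ Relation.TransGen D.Adj v v

/-- The alphabet for lists of arcs. -/
inductive GraphSymbol
  | vertex
  | arc
  | tail
  | head
  | endMark
  deriving DecidableEq

instance : Fintype GraphSymbol :=
  ⟨{.vertex, .arc, .tail, .head, .endMark}, by intro x; cases x <;> simp⟩

/-- One mark for every vertex, then every arc with its two ends in unary, then an end mark. -/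
def ArcList.encode (A : ArcList) : List GraphSymbol :=
  List.replicate A.m .vertex ++
    A.arcs.flatMap (fun a =>
      .arc :: (List.replicate a.1.val .tail ++ List.replicate a.2.val .head)) ++ [.endMark]

/-- The graph isomorphism problem: are two given finite graphs isomorphic? -/
def graphIsomorphism : DecisionProblem where
  Instance := ArcList × ArcList
  Alphabet := GraphSymbol
  encode x := x.1.encode ++ x.2.encode
  size x := (x.1.encode ++ x.2.encode).length
  size_le _ := le_rfl
  yes := {x | Nonempty (x.1.toGraph ≃g x.2.toGraph)}

/-- The isomorphism problem for (unlabelled) acyclic directed graphs. -/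
def acyclicDigraphIsomorphism : DecisionProblem where
  Instance := {A : ArcList // A.toDigraph.IsAcyclic} × {A : ArcList // A.toDigraph.IsAcyclic}
  Alphabet := GraphSymbol
  encode x := x.1.1.encode ++ x.2.1.encode
  size x := (x.1.1.encode ++ x.2.1.encode).length
  size_le _ := le_rfl
  yes := {x | Nonempty (x.1.1.toDigraph.Adj ≃r x.2.1.toDigraph.Adj)}

/-! ### The locked structure of a matroid -/

namespace Matroid

variable {α : Type*}

/-- `X` is a separator of `M`: a subset of the ground set with `r(X) + r(E \ X) = r(E)`. -/
def IsSeparator (M : Matroid α) (X : Set α) : Prop :=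
  X ⊆ M.E ∧ M.eRk X + M.eRk (M.E \ X) = M.eRk M.E

/-- `M` is 2-connected: it has no 1-separation, that is, no separator other than the empty set and
the ground set. -/
def TwoConnected (M : Matroid α) : Prop :=
  ∀ X, M.IsSeparator X → X = ∅ ∨ X = M.E

/-- The (2-connected) components of `M`: its minimal nonempty separators. -/
def components (M : Matroid α) : Set (Set α) :=
  {C | Minimal (fun X => X.Nonempty ∧ M.IsSeparator X) C}

/-- The locked subsets of a 2-connected matroid. -/
def IsLockedConnected (M : Matroid α) (L : Set α) : Prop :=
  L ⊆ M.E ∧ (M ↾ L).TwoConnected ∧ (M✶ ↾ (M.E \ L)).TwoConnected ∧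
    2 ≤ M.eRk L ∧ 2 ≤ M✶.eRk (M.E \ L)

/-- The locked subsets of a matroid: those of its 2-connected components. For a 2-connected matroid
the only component is the ground set. -/
def lockedSubsets (M : Matroid α) : Set (Set α) :=
  {L | ∃ C ∈ M.components, (M ↾ C).IsLockedConnected L}

/-- The locked number `ℓ(M)`. -/
noncomputable def lockedNumber (M : Matroid α) : ℕ := M.lockedSubsets.ncard

/-- The parallel closures: the classes of the relation "equal or parallel" on the ground set. -/
def parallelClosures (M : Matroid α) : Set (Set α) :=
  {P | ∃ e ∈ M.E, P = {f ∈ M.E | f = e ∨ M.IsCircuit {e, f}}}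

/-- The coparallel closures: the parallel closures of the dual. -/
def coparallelClosures (M : Matroid α) : Set (Set α) := M✶.parallelClosures

end Matroid

/-! ### Matroid isomorphism for matroids given by their locked structures -/

/-- A finite matroid, on the ground set `{0, …, n - 1}`. -/
structure FiniteMatroid where
  n : ℕ
  matroid : Matroid (Fin n)
  ground_eq : matroid.E = Set.univ

/-- Two matroids are isomorphic if some bijection of the ground sets carries the bases of one to
the bases of the other. -/
def FiniteMatroid.Isomorphic (M N : FiniteMatroid) : Prop :=
  ∃ φ : Fin M.n ≃ Fin N.n, ∀ B, M.matroid.IsBase B ↔ N.matroid.IsBase (φ '' B)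

/-- A class of finite matroids is `k`-locked if `ℓ(M) = O(|E|^k)` for the members `M` of the
class. -/
def IsLockedClass (k : ℕ) (C : Set FiniteMatroid) : Prop :=
  ∃ c : ℕ, ∀ M ∈ C, M.matroid.lockedNumber ≤ c * M.n ^ k

/-- The four kinds of sets that a locked structure records. -/
inductive SetKind
  | component
  | parallel
  | coparallel
  | locked
  deriving DecidableEq

instance : Fintype SetKind :=
  ⟨{.component, .parallel, .coparallel, .locked}, by intro x; cases x <;> simp⟩

/-- The sets of a given kind. -/
def SetKind.family {α : Type*} (M : Matroid α) : SetKind → Set (Set α)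
  | .component => M.components
  | .parallel => M.parallelClosures
  | .coparallel => M.coparallelClosures
  | .locked => M.lockedSubsets

/-- A table of sets with their ranks, one list for every kind of sets. -/
structure LockedTable (n : ℕ) where
  entries : SetKind → List (Finset (Fin n) × ℕ)

/-- The table is the locked structure of `M`: without repetitions, and in an arbitrary order, it
lists the components, the parallel closures, the coparallel closures and the locked subsets of `M`,
each with its rank. For a 2-connected matroid with nonempty ground set `E`, the first list consists
of `E` with its rank only. -/
def LockedTable.Represents {n : ℕ} (T : LockedTable n) (M : Matroid (Fin n)) : Prop :=
  ∀ κ : SetKind, (T.entries κ).Nodup ∧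
    ∀ (X : Finset (Fin n)) (r : ℕ),
      (X, r) ∈ T.entries κ ↔ (X : Set (Fin n)) ∈ κ.family M ∧ (r : ℕ∞) = M.eRk (X : Set (Fin n))

/-- The alphabet for tables. -/
inductive TableSymbol
  | element
  | kind (κ : SetKind)
  | bit (b : Bool)
  | rank
  | endMark
  deriving DecidableEq, Fintype

/-- An entry: its kind, the characteristic vector of the set, and its rank in unary. -/
def encodeEntry {n : ℕ} (κ : SetKind) (X : Finset (Fin n) × ℕ) : List TableSymbol :=
  .kind κ :: ((List.finRange n).map (fun e => .bit (decide (e ∈ X.1))) ++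
    List.replicate X.2 .rank)

/-- One mark for every element of the ground set, then all entries, then an end mark. -/
def LockedTable.encode {n : ℕ} (T : LockedTable n) : List TableSymbol :=
  List.replicate n .element ++
    (T.entries .component).flatMap (encodeEntry .component) ++
    (T.entries .parallel).flatMap (encodeEntry .parallel) ++
    (T.entries .coparallel).flatMap (encodeEntry .coparallel) ++
    (T.entries .locked).flatMap (encodeEntry .locked) ++ [.endMark]

/-- A matroid of the class `C`, given by its locked structure. -/
structure GivenMatroid (C : Set FiniteMatroid) where
  M : FiniteMatroid
  mem : M ∈ C
  table : LockedTable M.n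
  represents : table.Represents M.matroid

/-- The matroid isomorphism problem for a class of matroids given by their locked structures: are
two given members of the class isomorphic? Its size parameter is the total number of elements of the
two ground sets. -/
def matroidIsomorphism (C : Set FiniteMatroid) : DecisionProblem where
  Instance := GivenMatroid C × GivenMatroid C
  Alphabet := TableSymbol
  encode x := x.1.table.encode ++ x.2.table.encode
  size x := x.1.M.n + x.2.M.n
  size_le x := by
    simp only [LockedTable.encode, List.length_append, List.length_replicate]
    omega
  yes := {x | x.1.M.Isomorphic x.2.M}

/-!
# Isomorphism of matroids given by their locked structures

The reduction rests on two facts.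

**The locked structure determines the matroid** (`Matroid.isBase_iff_of_lockedStructure`): a set
`B` is a base exactly when `|B ∩ C| = r(C)` for every component `C`, `|B ∩ P| ≤ 1` for every
parallel closure `P`, `|S \ B| ≤ 1` for every coparallel closure `S`, and `|B ∩ L| ≤ r(L)` for
every locked subset `L`. If such a set `B` were dependent, a minimal `L` with `|B ∩ L| > r(L)`
would be connected and contained in one component `C`. Among the connected subsets of `C` with
this property take a maximal one. Since `|B ∩ C| = r(C)`, submodularity shows that contracting it
in `M | C` leaves a connected matroid (`Matroid.TwoConnected.exists_violated`). So it is locked,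
unless its rank or the corank of its complement in `C` is `1`; in these cases `B` contains two
parallel elements or misses two coparallel ones. Hence two matroids are isomorphic exactly when
some bijection of the ground sets matches their tables, ranks included
(`FiniteMatroid.isomorphic_iff_exists_isIso`).

**A table can be drawn as a graph.** One and the same list of arcs serves both reductions. Its
vertices are the elements of the ground set, the entries of the table, and pendant vertices, whose
number at an entry encodes the kind and the rank of the entry. An entry has arcs to its elements,
and pendant vertices have arcs to their entry. The vertices are numbered so that every arc goes
from a larger to a smaller number; so the directed graph is acyclic. An isomorphism of tables
gives one of directed graphs, hence one of the underlying undirected graphs. From the latter the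
table can be recovered (`TableVertex.exists_isIso_of_adj_iff`): pendant vertices are those with a
single neighbour, entries are their neighbours, and elements are the rest, because each element
lies in a parallel and in a coparallel closure.

The graph is built by a left fold over the symbols of the table (`Layout.step`). The Turing
machine `GraphMachine.machine` carries out this fold with unary counters, in time quadratic in the
length of the table, which in turn is polynomial in the size of the ground set for a `k`-locked
class.
-/

/-! ### Ranks, separators and components -/

namespace Matroid

variable {α : Type*} {M : Matroid α} {X Y C L B : Set α}

/-- The rank as a natural number; for a set of infinite rank it is `0`, so it is used on finite
types only. -/
noncomputable def natRk (M : Matroid α) (X : Set α) : ℕ := (M.eRk X).toNat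

lemma natRk_empty (M : Matroid α) : M.natRk ∅ = 0 := by simp [natRk]

lemma natRk_restrict (M : Matroid α) (h : X ⊆ Y) : (M ↾ Y).natRk X = M.natRk X := by
  rw [natRk, restrict_eRk_eq _ h, natRk]

lemma mem_components_iff :
    C ∈ M.components ↔ Minimal (fun X => X.Nonempty ∧ M.IsSeparator X) C := Iff.rfl

lemma component_nonempty (hC : C ∈ M.components) : C.Nonempty :=
  (mem_components_iff.1 hC).prop.1

lemma component_isSeparator (hC : C ∈ M.components) : M.IsSeparator C :=
  (mem_components_iff.1 hC).prop.2

lemma component_subset_ground (hC : C ∈ M.components) : C ⊆ M.E := (component_isSeparator hC).1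

lemma component_subset_of_subset (hC : C ∈ M.components) (hX : X.Nonempty)
    (hXs : M.IsSeparator X) (hXC : X ⊆ C) : C ⊆ X :=
  (mem_components_iff.1 hC).le_of_le ⟨hX, hXs⟩ hXC

variable [Finite α]

lemma coe_natRk (M : Matroid α) (X : Set α) : (M.natRk X : ℕ∞) = M.eRk X := by
  refine ENat.natCast_toNat (ne_top_of_le_ne_top ?_ (M.eRk_le_encard X))
  exact (Set.toFinite X).encard_lt_top.ne

lemma natRk_mono (M : Matroid α) (h : X ⊆ Y) : M.natRk X ≤ M.natRk Y := by
  have := M.eRk_mono h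
  rw [← coe_natRk, ← coe_natRk] at this
  exact_mod_cast this

lemma natRk_submod (M : Matroid α) (X Y : Set α) :
    M.natRk (X ∩ Y) + M.natRk (X ∪ Y) ≤ M.natRk X + M.natRk Y := by
  have := M.eRk_inter_add_eRk_union_le X Y
  simp only [← coe_natRk] at this
  exact_mod_cast this

lemma natRk_union_le (M : Matroid α) (X Y : Set α) :
    M.natRk (X ∪ Y) ≤ M.natRk X + M.natRk Y := by
  have := M.natRk_submod X Y
  omega

lemma natRk_le_ncard (M : Matroid α) (X : Set α) : M.natRk X ≤ X.ncard := by
  have := M.eRk_le_encard X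
  rw [← coe_natRk, ← (Set.toFinite X).cast_ncard_eq] at this
  exact_mod_cast this

lemma indep_iff_natRk : M.Indep X ↔ M.natRk X = X.ncard := by
  rw [indep_iff_eRk_eq_encard_of_finite X.toFinite, ← coe_natRk, ← (Set.toFinite X).cast_ncard_eq]
  exact_mod_cast Iff.rfl

lemma natRk_dual_add (M : Matroid α) (h : X ⊆ M.E) :
    M✶.natRk X + M.natRk M.E = M.natRk (M.E \ X) + X.ncard := by
  have := M.eRk_dual_add_eRank X h
  rw [← eRk_ground] at this
  simp only [← coe_natRk, ← (Set.toFinite X).cast_ncard_eq] at this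
  exact_mod_cast this

lemma isSeparator_iff :
    M.IsSeparator X ↔ X ⊆ M.E ∧ M.natRk X + M.natRk (M.E \ X) = M.natRk M.E := by
  simp only [IsSeparator, ← coe_natRk]
  exact_mod_cast Iff.rfl

lemma isSeparator_ground (M : Matroid α) : M.IsSeparator M.E := by
  simp [isSeparator_iff, natRk_empty]

lemma IsSeparator.compl (h : M.IsSeparator X) : M.IsSeparator (M.E \ X) := by
  rw [isSeparator_iff] at h ⊢
  rw [Set.sdiff_sdiff_cancel_left h.1]
  exact ⟨Set.sdiff_subset, by omega⟩

/-- By submodularity, the inequality `r(X) + r(E \ X) ≤ r(E)` already characterizes separators. -/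
lemma isSeparator_of_le (hX : X ⊆ M.E) (h : M.natRk X + M.natRk (M.E \ X) ≤ M.natRk M.E) :
    M.IsSeparator X := by
  refine isSeparator_iff.2 ⟨hX, le_antisymm h ?_⟩
  have := M.natRk_union_le X (M.E \ X)
  rwa [Set.union_sdiff_cancel hX] at this

lemma IsSeparator.inter (hX : M.IsSeparator X) (hY : M.IsSeparator Y) :
    M.IsSeparator (X ∩ Y) := by
  rw [isSeparator_iff] at hX hY
  refine isSeparator_of_le (Set.inter_subset_left.trans hX.1) ?_
  have h1 := M.natRk_submod X Y
  have h2 := M.natRk_submod (M.E \ X) (M.E \ Y)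
  rw [← Set.sdiff_inter, ← show M.E \ (X ∪ Y) = M.E \ X ∩ (M.E \ Y) by ext e; simp; tauto] at h2
  have h3 := M.natRk_union_le (X ∪ Y) (M.E \ (X ∪ Y))
  rw [Set.union_sdiff_cancel (Set.union_subset hX.1 hY.1)] at h3
  omega

/-- The rank function splits along a separator. -/
lemma IsSeparator.natRk_eq (hC : M.IsSeparator C) (hX : X ⊆ M.E) :
    M.natRk X = M.natRk (X ∩ C) + M.natRk (X \ C) := by
  rw [isSeparator_iff] at hC
  have h1 := M.natRk_submod X C
  have h2 := M.natRk_submod (X ∪ C) (M.E \ C)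
  have e1 : (X ∪ C) ∩ (M.E \ C) = X \ C := by
    ext e; have := @hX e; simp only [Set.mem_inter_iff, Set.mem_union, Set.mem_sdiff]; tauto
  have e2 : (X ∪ C) ∪ (M.E \ C) = M.E := by
    ext e; have := @hX e; have := @hC.1 e
    simp only [Set.mem_union, Set.mem_sdiff]; tauto
  rw [e1, e2] at h2
  have h3 := M.natRk_union_le (X ∩ C) (X \ C)
  rw [Set.inter_union_sdiff] at h3
  omega

lemma exists_component_mem {e : α} (he : e ∈ M.E) : ∃ C ∈ M.components, e ∈ C := by
  obtain ⟨C, hC⟩ := (Set.toFinite {X | e ∈ X ∧ M.IsSeparator X}).exists_minimal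
    ⟨M.E, he, M.isSeparator_ground⟩
  refine ⟨C, ⟨⟨⟨e, hC.prop.1⟩, hC.prop.2⟩, fun D hD hDC => ?_⟩, hC.prop.1⟩
  by_cases heD : e ∈ D
  · exact hC.le_of_le ⟨heD, hD.2⟩ hDC
  -- otherwise `C \ D` is a smaller separator containing `e`
  obtain ⟨d, hd⟩ := hD.1
  have hmem : e ∈ C ∩ (M.E \ D) := ⟨hC.prop.1, he, heD⟩
  have := hC.le_of_le ⟨hmem, hC.prop.2.inter hD.2.compl⟩ Set.inter_subset_left (hDC hd)
  exact absurd hd this.2.2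

lemma components_eq_of_mem {D : Set α} {e : α} (hC : C ∈ M.components) (hD : D ∈ M.components)
    (heC : e ∈ C) (heD : e ∈ D) : C = D := by
  have h := (component_isSeparator hC).inter (component_isSeparator hD)
  have hne : (C ∩ D).Nonempty := ⟨e, heC, heD⟩
  exact ((component_subset_of_subset hC hne h Set.inter_subset_left).trans
    Set.inter_subset_right).antisymm
    ((component_subset_of_subset hD hne h Set.inter_subset_right).trans Set.inter_subset_left)

/-- A separation of a component would be a separation of the whole matroid. -/
lemma twoConnected_restrict_of_mem_components (hC : C ∈ M.components) :
    (M ↾ C).TwoConnected := by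
  intro X hX
  rw [isSeparator_iff] at hX
  simp only [restrict_ground_eq] at hX ⊢
  obtain ⟨hXC, hX⟩ := hX
  rw [natRk_restrict _ hXC, natRk_restrict _ Set.sdiff_subset, natRk_restrict _ subset_rfl] at hX
  have hCs := isSeparator_iff.1 (component_isSeparator hC)
  have hsep : M.IsSeparator X := by
    refine isSeparator_of_le (hXC.trans hCs.1) ?_
    have := M.natRk_union_le (C \ X) (M.E \ C)
    have e : (C \ X) ∪ (M.E \ C) = M.E \ X := by
      ext e; have := @hXC e; have := @hCs.1 e
      simp only [Set.mem_union, Set.mem_sdiff]; tauto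
    rw [e] at this
    omega
  rcases X.eq_empty_or_nonempty with h | h
  · exact .inl h
  · exact .inr (hXC.antisymm (component_subset_of_subset hC h hsep hXC))

lemma twoConnected_restrict_iff : (M ↾ L).TwoConnected ↔
    ∀ X ⊆ L, M.natRk X + M.natRk (L \ X) = M.natRk L → X = ∅ ∨ X = L := by
  refine forall_congr' fun X => ?_
  rw [isSeparator_iff, and_imp]
  refine imp_congr_right fun hX => ?_
  have hX' : X ⊆ L := hX
  simp only [restrict_ground_eq]
  rw [natRk_restrict _ hX', natRk_restrict _ Set.sdiff_subset, natRk_restrict _ subset_rfl]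

/-- Adding to a connected set `L` one side `X` of a separation of `M / L` gives a connected set. -/
lemma twoConnected_restrict_union (hM : M.TwoConnected) (hL : L ⊆ M.E) (hne : L.Nonempty)
    (hLc : (M ↾ L).TwoConnected) (hX : X ⊆ M.E \ L)
    (hsep : M.natRk (L ∪ X) + M.natRk (M.E \ X) = M.natRk M.E + M.natRk L) :
    (M ↾ (L ∪ X)).TwoConnected := by
  rw [twoConnected_restrict_iff] at hLc ⊢
  have hXE : X ⊆ M.E := hX.trans Set.sdiff_subset
  have key : ∀ A ⊆ L ∪ X, L ⊆ A → M.natRk A + M.natRk ((L ∪ X) \ A) = M.natRk (L ∪ X) →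
      A = L ∪ X := by
    intro A hA hLA h
    have hBsep : M.IsSeparator ((L ∪ X) \ A) := by
      refine isSeparator_of_le (Set.sdiff_subset.trans (Set.union_subset hL hXE)) ?_
      have h1 := M.natRk_submod A (M.E \ X)
      have e1 : A ∩ (M.E \ X) = L := by
        ext e; have := @hA e; have := @hLA e; have := @hL e; have := @hX e
        simp only [Set.mem_inter_iff, Set.mem_sdiff, Set.mem_union] at *; tauto
      have e2 : A ∪ (M.E \ X) = M.E \ ((L ∪ X) \ A) := by
        ext e; have := @hA e; have := @hLA e; have := @hL e; have := @hX e
        simp only [Set.mem_sdiff, Set.mem_union] at *; tauto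
      rw [e1, e2] at h1
      omega
    rcases hM _ hBsep with h' | h'
    · exact hA.antisymm (Set.sdiff_eq_empty.1 h')
    · obtain ⟨e, he⟩ := hne
      exact absurd (hLA he) (h'.ge (hL he)).2
  intro A hA h
  -- a separation of `L ∪ X` induces one of `L`
  have hLsep : M.natRk (A ∩ L) + M.natRk (L \ A) = M.natRk L := by
    have hs : (M ↾ (L ∪ X)).IsSeparator A := by
      rw [isSeparator_iff]
      simp only [restrict_ground_eq]
      rw [natRk_restrict _ hA, natRk_restrict _ Set.sdiff_subset, natRk_restrict _ subset_rfl]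
      exact ⟨hA, h⟩
    have := hs.natRk_eq (X := L) (by simp)
    rw [natRk_restrict _ (by simp), natRk_restrict _ (Set.inter_subset_left.trans (by simp)),
      natRk_restrict _ (Set.sdiff_subset.trans (by simp)), Set.inter_comm] at this
    exact this.symm
  have e : L \ (A ∩ L) = L \ A := by simp
  rcases hLc (A ∩ L) Set.inter_subset_right (by rw [e]; exact hLsep) with h0 | h0
  · left
    have hLA : L ⊆ (L ∪ X) \ A := fun e he =>
      ⟨.inl he, fun heA => Set.notMem_empty e (h0 ▸ ⟨heA, he⟩)⟩
    have := key _ Set.sdiff_subset hLA (by rw [Set.sdiff_sdiff_cancel_left hA]; omega)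
    ext e
    have h1 : e ∈ A → e ∈ (L ∪ X) \ A := fun he => this.ge (hA he)
    simp only [Set.mem_empty_iff_false, iff_false]
    exact fun he => (h1 he).2 he
  · exact .inr (key A hA (Set.inter_eq_right.1 h0) h)

end Matroid

/-! ### Violated rank inequalities in 2-connected matroids -/

namespace Matroid

variable {α : Type*} [Finite α] {M : Matroid α} {X Y C L B : Set α}

lemma isCircuit_pair {e f : α} (hne : e ≠ f) (he : M.natRk {e} = 1) (hf : M.natRk {f} = 1)
    (hef : M.natRk {e, f} ≤ 1) (heE : e ∈ M.E) (hfE : f ∈ M.E) : M.IsCircuit {e, f} := by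
  rw [isCircuit_iff_forall_ssubset]
  have hi : ∀ g, M.natRk {g} = 1 → M.Indep {g} := fun g hg => by
    rw [indep_iff_natRk, hg, Set.ncard_singleton]
  refine ⟨⟨fun h => ?_, Set.pair_subset heE hfE⟩, fun I hI => ?_⟩
  · rw [indep_iff_natRk, Set.ncard_pair hne] at h
    omega
  · rcases (Set.subset_pair_iff_eq.1 hI.subset) with h | h | h | h
    · simp [h]
    · exact h ▸ hi e he
    · exact h ▸ hi f hf
    · exact absurd h hI.ne

/-- A 2-connected matroid with at least two elements has neither loops nor coloops. -/
lemma TwoConnected.natRk_singleton (hM : M.TwoConnected) {e : α} (he : e ∈ M.E)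
    (hne : M.E ≠ {e}) : M.natRk {e} = 1 ∧ M✶.natRk {e} = 1 := by
  have heE : ({e} : Set α) ⊆ M.E := Set.singleton_subset_iff.2 he
  have hns : ¬ M.IsSeparator {e} := fun h => by
    rcases hM _ h with h | h
    · exact Set.singleton_ne_empty e h
    · exact hne h.symm
  have h1 := M.natRk_le_ncard {e}
  have h2 := M✶.natRk_le_ncard {e}
  have h3 := M.natRk_dual_add heE
  have h4 := M.natRk_mono (X := M.E \ {e}) Set.sdiff_subset
  rw [Set.ncard_singleton] at h1 h2 h3
  have h5 : ¬ M.natRk {e} + M.natRk (M.E \ {e}) ≤ M.natRk M.E :=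
    fun h => hns (isSeparator_of_le heE h)
  omega

/-- In a 2-connected matroid, a set of the cardinality of a base that violates some rank inequality
`|B ∩ L| ≤ r(L)` contains two parallel elements, or misses two coparallel elements, or violates
the rank inequality of a locked set. -/
lemma TwoConnected.exists_violated (hM : M.TwoConnected) (hBE : B ⊆ M.E)
    (hB : B.ncard = M.natRk M.E) (hL : L ⊆ M.E) (hf : M.natRk L < (B ∩ L).ncard) :
    (∃ e ∈ B, ∃ f ∈ B, e ≠ f ∧ M.IsCircuit {e, f}) ∨
    (∃ e ∈ M.E \ B, ∃ f ∈ M.E \ B, e ≠ f ∧ M✶.IsCircuit {e, f}) ∨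
    ∃ L, M.IsLockedConnected L ∧ M.natRk L < (B ∩ L).ncard := by
  have hsplit : ∀ X Y : Set α, (B ∩ X).ncard = (B ∩ X ∩ Y).ncard + ((B ∩ X) \ Y).ncard :=
    fun X Y => (Set.ncard_inter_add_ncard_sdiff_eq_ncard _ _ (Set.toFinite _)).symm
  -- a minimal violated set is connected
  obtain ⟨L₀, hL₀⟩ := (Set.toFinite {X | X ⊆ M.E ∧ M.natRk X < (B ∩ X).ncard}).exists_minimal
    ⟨L, hL, hf⟩
  have hc₀ : (M ↾ L₀).TwoConnected := by
    rw [twoConnected_restrict_iff]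
    intro X hX h
    have h1 := hsplit L₀ X
    rw [Set.inter_assoc, Set.inter_eq_right.2 hX, Set.inter_sdiff_assoc] at h1
    have h0 := hL₀.prop.2
    by_cases hX1 : M.natRk X < (B ∩ X).ncard
    · exact .inr (hX.antisymm (hL₀.le_of_le ⟨hX.trans hL₀.prop.1, hX1⟩ hX))
    · have hX2 : M.natRk (L₀ \ X) < (B ∩ (L₀ \ X)).ncard := by omega
      have := hL₀.le_of_le ⟨Set.sdiff_subset.trans hL₀.prop.1, hX2⟩ Set.sdiff_subset
      exact .inl (Set.eq_empty_iff_forall_notMem.2 fun e he => (this (hX he)).2 he)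
  -- take a maximal connected violated set
  obtain ⟨L, hLmax⟩ := (Set.toFinite {X | X ⊆ M.E ∧ M.natRk X < (B ∩ X).ncard ∧
    (M ↾ X).TwoConnected}).exists_maximal ⟨L₀, hL₀.prop.1, hL₀.prop.2, hc₀⟩
  obtain ⟨hLE, hf, hLc⟩ := hLmax.prop
  have hLne : L.Nonempty := by
    rw [Set.nonempty_iff_ne_empty]; rintro rfl; simp at hf
  have hLE' : L ≠ M.E := by
    rintro rfl
    rw [Set.inter_eq_left.2 hBE] at hf
    omega
  have hdual := M.natRk_dual_add (X := M.E \ L) Set.sdiff_subset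
  rw [Set.sdiff_sdiff_cancel_left hLE] at hdual
  have hLBc : B.ncard = (B ∩ L).ncard + (B \ L).ncard :=
    (Set.ncard_inter_add_ncard_sdiff_eq_ncard _ _ (Set.toFinite _)).symm
  have hcompl : (M.E \ L).ncard = (B \ L).ncard + ((M.E \ L) \ B).ncard := by
    rw [← Set.ncard_inter_add_ncard_sdiff_eq_ncard (M.E \ L) B (Set.toFinite _)]
    congr 2
    ext e; have := @hBE e; simp only [Set.mem_inter_iff, Set.mem_sdiff]; tauto
  -- then `M / L` is connected as well
  have hdc : (M✶ ↾ (M.E \ L)).TwoConnected := by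
    rw [twoConnected_restrict_iff]
    intro X hX h
    by_contra! hcon
    have hXE : X ⊆ M.E := hX.trans Set.sdiff_subset
    set Y := (M.E \ L) \ X with hY
    have hYE : Y ⊆ M.E := Set.sdiff_subset.trans Set.sdiff_subset
    have hYL : Y ⊆ M.E \ L := Set.sdiff_subset
    have dX := M.natRk_dual_add hXE
    have dY := M.natRk_dual_add hYE
    have eX : M.E \ X = L ∪ Y := by
      ext e; have := @hX e; have := @hLE e
      simp only [hY, Set.mem_sdiff, Set.mem_union] at *; tauto
    have eY : M.E \ Y = L ∪ X := by
      ext e; have := @hX e; have := @hLE e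
      simp only [hY, Set.mem_sdiff, Set.mem_union] at *; tauto
    have hcard : (M.E \ L).ncard = X.ncard + Y.ncard := by
      rw [hY, ← Set.ncard_sdiff_add_ncard_of_subset hX, add_comm]
    have hsep : M.natRk (L ∪ X) + M.natRk (L ∪ Y) = M.natRk M.E + M.natRk L := by
      rw [eX] at dX; rw [eY] at dY; omega
    have hX' := twoConnected_restrict_union hM hLE hLne hLc hX (by rw [eX]; exact hsep)
    have hY' := twoConnected_restrict_union hM hLE hLne hLc hYL (by rw [eY]; omega)
    have nX : ¬ M.natRk (L ∪ X) < (B ∩ (L ∪ X)).ncard := fun h => by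
      have := hLmax.le_of_ge ⟨Set.union_subset hLE hXE, h, hX'⟩ Set.subset_union_left
      obtain ⟨e, he⟩ := hcon.1
      exact (hX he).2 (this (.inr he))
    have nY : ¬ M.natRk (L ∪ Y) < (B ∩ (L ∪ Y)).ncard := fun h => by
      have := hLmax.le_of_ge ⟨Set.union_subset hLE hYE, h, hY'⟩ Set.subset_union_left
      refine hcon.2 (hX.antisymm fun e he => ?_)
      by_contra heX
      exact he.2 (this (.inr ⟨he, heX⟩))
    have cX : (B ∩ (L ∪ X)).ncard = (B ∩ L).ncard + (B ∩ X).ncard := by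
      rw [Set.inter_union_distrib_left, Set.ncard_union_eq]
      exact Set.disjoint_left.2 fun e he he' => (hX he'.2).2 he.2
    have cY : (B ∩ (L ∪ Y)).ncard = (B ∩ L).ncard + (B ∩ Y).ncard := by
      rw [Set.inter_union_distrib_left, Set.ncard_union_eq]
      exact Set.disjoint_left.2 fun e he he' => (hYL he'.2).2 he.2
    have cB : (B \ L).ncard = (B ∩ X).ncard + (B ∩ Y).ncard := by
      rw [← Set.ncard_union_eq]
      · congr 1
        ext e; have := @hBE e; have := @hX e
        simp only [hY, Set.mem_sdiff, Set.mem_union, Set.mem_inter_iff] at *; tauto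
      · exact Set.disjoint_left.2 fun e he he' => he'.2.2 he.2
    omega
  have hEs : ∀ e, M.E ≠ {e} := by
    rintro e he
    rcases Set.subset_singleton_iff_eq.1 (he ▸ hLE) with h | h
    · exact hLne.ne_empty h
    · exact hLE' (h.trans he.symm)
  by_cases hr : M.natRk L ≤ 1
  · -- `B ∩ L` contains two parallel elements
    left
    have h2 : 1 < (B ∩ L).ncard := by
      obtain ⟨x, hx⟩ := hLne
      have := M.natRk_mono (Set.singleton_subset_iff.2 hx)
      have := (hM.natRk_singleton (hLE hx) (hEs x)).1
      omega
    obtain ⟨e, he, f, hf', hne⟩ := (Set.one_lt_ncard (Set.toFinite _)).1 h2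
    refine ⟨e, he.1, f, hf'.1, hne, isCircuit_pair hne ?_ ?_ ?_ (hLE he.2) (hLE hf'.2)⟩
    · exact (hM.natRk_singleton (hLE he.2) (hEs e)).1
    · exact (hM.natRk_singleton (hLE hf'.2) (hEs f)).1
    · exact (M.natRk_mono (Set.pair_subset he.2 hf'.2)).trans hr
  by_cases hr' : M✶.natRk (M.E \ L) ≤ 1
  · -- the complement of `L` contains two coparallel elements outside `B`
    right; left
    have h1 : 0 < M✶.natRk (M.E \ L) := by
      obtain ⟨x, hx⟩ : (M.E \ L).Nonempty :=
        Set.nonempty_of_not_subset fun h => hLE' (hLE.antisymm h)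
      have := M✶.natRk_mono (Set.singleton_subset_iff.2 hx)
      have := (hM.natRk_singleton hx.1 (hEs x)).2
      omega
    have h2 : 1 < ((M.E \ L) \ B).ncard := by omega
    obtain ⟨e, he, f, hf', hne⟩ := (Set.one_lt_ncard (Set.toFinite _)).1 h2
    refine ⟨e, ⟨he.1.1, he.2⟩, f, ⟨hf'.1.1, hf'.2⟩, hne,
      isCircuit_pair hne ?_ ?_ ?_ he.1.1 hf'.1.1⟩
    · exact (hM.natRk_singleton he.1.1 (hEs e)).2
    · exact (hM.natRk_singleton hf'.1.1 (hEs f)).2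
    · exact (M✶.natRk_mono (Set.pair_subset he.1 hf'.1)).trans hr'
  · refine .inr (.inr ⟨L, ⟨hLE, hLc, hdc, ?_, ?_⟩, hf⟩)
    · rw [← coe_natRk]; exact_mod_cast (by omega : 2 ≤ M.natRk L)
    · rw [← coe_natRk]; exact_mod_cast (by omega : 2 ≤ M✶.natRk (M.E \ L))

end Matroid

/-! ### The locked structure determines the bases and is invariant under isomorphisms -/

namespace Matroid

variable {α β : Type*} {M : Matroid α}

lemma exists_mem_parallelClosure {e : α} (he : e ∈ M.E) :
    ∃ P ∈ M.parallelClosures, e ∈ P ∧ ∀ f ∈ M.E, M.IsCircuit {e, f} → f ∈ P :=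
  ⟨_, ⟨e, he, rfl⟩, ⟨he, .inl rfl⟩, fun _ hf h => ⟨hf, .inr h⟩⟩

section Finite

variable [Finite α] {C P L B : Set α}

/-- Elements that are coparallel in a component are coparallel: the dual of the restriction to a
component has the same rank function as the restriction of the dual. -/
lemma isCircuit_pair_of_restrict_dual (hC : C ∈ M.components) {e f : α} (hne : e ≠ f)
    (h : (M ↾ C)✶.IsCircuit {e, f}) : M✶.IsCircuit {e, f} := by
  have hrk : ∀ X ⊆ C, (M ↾ C)✶.natRk X = M✶.natRk X := by
    intro X hX
    have hsep := isSeparator_iff.1 (component_isSeparator hC)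
    have h1 := (M ↾ C).natRk_dual_add (X := X) hX
    have h2 := M.natRk_dual_add (hX.trans hsep.1)
    have h3 := (component_isSeparator hC).natRk_eq (X := M.E \ X) Set.sdiff_subset
    rw [restrict_ground_eq, natRk_restrict _ subset_rfl, natRk_restrict _ Set.sdiff_subset] at h1
    have e1 : (M.E \ X) ∩ C = C \ X := by
      ext e; have := @hsep.1 e; simp only [Set.mem_inter_iff, Set.mem_sdiff]; tauto
    have e2 : (M.E \ X) \ C = M.E \ C := by
      ext e; have := @hX e; simp only [Set.mem_sdiff]; tauto
    rw [e1, e2] at h3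
    omega
  have hE : ({e, f} : Set α) ⊆ C := h.subset_ground
  have hs : ∀ g ∈ ({e, f} : Set α), M✶.natRk {g} = 1 := by
    intro g hg
    have hi : (M ↾ C)✶.Indep {g} := by
      refine h.ssubset_indep ((Set.singleton_subset_iff.2 hg).ssubset_of_ne fun h' => ?_)
      have := congrArg Set.ncard h'
      rw [Set.ncard_singleton, Set.ncard_pair hne] at this
      omega
    rw [← hrk _ (Set.singleton_subset_iff.2 (hE hg)), indep_iff_natRk.1 hi, Set.ncard_singleton]
  refine isCircuit_pair hne (hs e (by simp)) (hs f (by simp)) ?_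
    (component_subset_ground hC (hE (by simp))) (component_subset_ground hC (hE (by simp)))
  have h1 := (M ↾ C)✶.natRk_le_ncard {e, f}
  have h2 := mt indep_iff_natRk.2 h.not_indep
  rw [Set.ncard_pair hne] at h1 h2
  rw [← hrk _ hE]
  omega

/-- An independent set meets every parallel closure at most once. The parallel closure of a loop `g`
is `{g}`. -/
lemma ncard_inter_parallelClosure_le (hB : M.Indep B) (hP : P ∈ M.parallelClosures) :
    (B ∩ P).ncard ≤ 1 := by
  obtain ⟨g, hg, rfl⟩ := hP
  by_contra! h
  obtain ⟨e, he, f, hf, hne⟩ := (Set.one_lt_ncard (Set.toFinite _)).1 h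
  have hr : ∀ x, x ∈ {f ∈ M.E | f = g ∨ M.IsCircuit {g, f}} → M.natRk {g, x} ≤ 1 := by
    rintro x ⟨-, rfl | hx⟩
    · simpa using M.natRk_le_ncard {x}
    · have h1 := M.natRk_le_ncard {g, x}
      have h2 := mt indep_iff_natRk.2 hx.not_indep
      have h3 := Set.ncard_insert_le g {x}
      rw [Set.ncard_singleton] at h3
      omega
  have h1 := M.natRk_submod {g, e} {g, f}
  have h2 := hr e he.2
  have h3 := hr f hf.2
  have h4 := M.natRk_mono (X := {e, f}) (Y := {g, e} ∪ {g, f}) (by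
    rintro x (rfl | rfl) <;> simp)
  have h5 := indep_iff_natRk.1 (hB.subset (Set.pair_subset he.1 hf.1))
  rw [Set.ncard_pair hne] at h5
  have h6 := M.natRk_mono (X := {g}) (Y := {g, e} ∩ {g, f}) (by simp)
  -- `g` is not a loop, because `e ≠ f` cannot both be equal to `g`
  have h7 : M.natRk {g} = 1 := by
    obtain ⟨x, hxg, hx⟩ : ∃ x, x ≠ g ∧ M.IsCircuit {g, x} := by
      rcases he.2.2 with h | h
      · rcases hf.2.2 with h' | h'
        · exact absurd (h.trans h'.symm) hne
        · exact ⟨f, fun h'' => hne (h.trans h''.symm), h'⟩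
      · by_cases h' : e = g
        · rcases hf.2.2 with h' | h'
          · exact absurd (‹e = g›.trans h'.symm) hne
          · exact ⟨f, fun h'' => hne (‹e = g›.trans h''.symm), h'⟩
        · exact ⟨e, h', h⟩
    rw [indep_iff_natRk.1 (hx.ssubset_indep ?_), Set.ncard_singleton]
    refine (Set.singleton_subset_iff.2 (by simp)).ssubset_of_ne fun h' => ?_
    exact hxg (h'.ge (by simp : x ∈ ({g, x} : Set α)))
  omega

/-- The locked structure determines the bases: on each component, the listed inequalities cut out
the bases among all sets of the right cardinality. -/
theorem isBase_iff_of_lockedStructure : M.IsBase B ↔ B ⊆ M.E ∧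
    (∀ C ∈ M.components, (B ∩ C).ncard = M.natRk C) ∧
    (∀ P ∈ M.parallelClosures, (B ∩ P).ncard ≤ 1) ∧
    (∀ S ∈ M.coparallelClosures, (S \ B).ncard ≤ 1) ∧
    ∀ L ∈ M.lockedSubsets, (B ∩ L).ncard ≤ M.natRk L := by
  constructor
  · intro hB
    have hle : ∀ X, (B ∩ X).ncard ≤ M.natRk X := fun X => by
      rw [← indep_iff_natRk.1 (hB.indep.subset Set.inter_subset_left)]
      exact M.natRk_mono Set.inter_subset_right
    refine ⟨hB.subset_ground, fun C hC => le_antisymm (hle C) ?_, fun P hP =>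
      ncard_inter_parallelClosure_le hB.indep hP, fun S hS => ?_, fun L _ => hle L⟩
    · have hsep := isSeparator_iff.1 (component_isSeparator hC)
      have h1 := hle (M.E \ C)
      have h2 : (B ∩ C).ncard + (B ∩ (M.E \ C)).ncard = B.ncard := by
        rw [← Set.ncard_inter_add_ncard_sdiff_eq_ncard B C (Set.toFinite _)]
        congr 2
        ext e; have := fun h : e ∈ B => hB.subset_ground h
        simp only [Set.mem_inter_iff, Set.mem_sdiff]; tauto
      have h3 := indep_iff_natRk.1 hB.indep
      have h4 : M.natRk B = M.natRk M.E := by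
        rw [natRk, natRk, hB.eRk_eq_eRank, eRk_ground]
      omega
    · have hSE : S ⊆ M.E := by obtain ⟨e, -, rfl⟩ := hS; exact fun x hx => hx.1
      have := ncard_inter_parallelClosure_le hB.compl_isBase_dual.indep hS
      rwa [show (M.E \ B) ∩ S = S \ B by
        ext e; have := @hSE e; simp only [Set.mem_inter_iff, Set.mem_sdiff]; tauto] at this
  · rintro ⟨hBE, hcomp, hpar, hcopar, hlock⟩
    have hindep : M.Indep B := by
      by_contra hdep
      rw [indep_iff_natRk] at hdep
      have hlt := lt_of_le_of_ne (M.natRk_le_ncard B) hdep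
      -- a minimal violated set lies in one component
      obtain ⟨L, hL⟩ := (Set.toFinite {X | X ⊆ M.E ∧ M.natRk X < (B ∩ X).ncard}).exists_minimal
        ⟨B, hBE, by rwa [Set.inter_self]⟩
      have hLv := hL.prop.2
      obtain ⟨x, hx⟩ : L.Nonempty := by
        rw [Set.nonempty_iff_ne_empty]; rintro rfl; simp at hLv
      obtain ⟨C, hC, hxC⟩ := M.exists_component_mem (hL.prop.1 hx)
      have hLC : L ⊆ C := by
        have h1 := (component_isSeparator hC).natRk_eq hL.prop.1
        have h2 := Set.ncard_inter_add_ncard_sdiff_eq_ncard (B ∩ L) C (Set.toFinite _)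
        rw [Set.inter_assoc, Set.inter_sdiff_assoc] at h2
        by_cases h3 : M.natRk (L ∩ C) < (B ∩ (L ∩ C)).ncard
        · exact (hL.le_of_le ⟨Set.inter_subset_left.trans hL.prop.1, h3⟩
            Set.inter_subset_left).trans Set.inter_subset_right
        · have := hL.le_of_le ⟨Set.sdiff_subset.trans hL.prop.1,
            (by omega : M.natRk (L \ C) < (B ∩ (L \ C)).ncard)⟩ Set.sdiff_subset
          exact absurd hxC (this hx).2
      have hCE := component_subset_ground hC
      have hBC : ∀ X ⊆ C, B ∩ C ∩ X = B ∩ X := fun X hX => by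
        rw [Set.inter_assoc, Set.inter_eq_right.2 hX]
      rcases (twoConnected_restrict_of_mem_components hC).exists_violated (B := B ∩ C) (L := L)
        Set.inter_subset_right (by
          rw [restrict_ground_eq, natRk_restrict _ subset_rfl, hcomp C hC]) hLC
        (by rwa [natRk_restrict _ hLC, hBC L hLC]) with
        ⟨e, he, f, hf, hne, h⟩ | ⟨e, he, f, hf, hne, h⟩ | ⟨L', hL', h⟩
      · obtain ⟨P, hP, heP, hfP⟩ := exists_mem_parallelClosure (M := M) (hCE he.2)
        have h' := (restrict_isCircuit_iff hCE).1 h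
        have := hpar P hP
        have h2 := Set.ncard_le_ncard (Set.pair_subset (s := B ∩ P) ⟨he.1, heP⟩
          ⟨hf.1, hfP f (hCE hf.2) h'.1⟩) (Set.toFinite _)
        rw [Set.ncard_pair hne] at h2
        omega
      · obtain ⟨P, hP, heP, hfP⟩ := exists_mem_parallelClosure (M := M✶) (hCE he.1)
        have h' := isCircuit_pair_of_restrict_dual hC hne h
        have := hcopar P hP
        have h2 := Set.ncard_le_ncard
          (Set.pair_subset (s := P \ B) ⟨heP, fun h => he.2 ⟨h, he.1⟩⟩
          ⟨hfP f (hCE hf.1) h', fun h => hf.2 ⟨h, hf.1⟩⟩) (Set.toFinite _)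
        rw [Set.ncard_pair hne] at h2
        omega
      · have hL'C : L' ⊆ C := hL'.1
        rw [natRk_restrict _ hL'C, hBC L' hL'C] at h
        exact absurd (hlock L' ⟨C, hC, hL'⟩) (not_le.2 h)
    by_contra hbase
    obtain ⟨B', hB'⟩ := M.exists_isBase
    obtain ⟨e, he, hi⟩ := hindep.exists_insert_of_not_isBase hbase hB'
    obtain ⟨C, hC, heC⟩ := M.exists_component_mem (hi.subset_ground (Set.mem_insert e B))
    have h1 := indep_iff_natRk.1 (hi.subset (Set.inter_subset_left (t := C)))
    have h2 := M.natRk_mono (X := insert e B ∩ C) Set.inter_subset_right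
    rw [Set.insert_inter_of_mem heC, Set.ncard_insert_of_notMem (fun h => he.2 h.1)] at h1
    rw [Set.insert_inter_of_mem heC] at h2
    have := hcomp C hC
    omega

end Finite

section Map

variable (M) (φ : α ≃ β)

lemma eRk_mapEquiv (X : Set α) : (M.mapEquiv φ).eRk (φ '' X) = M.eRk X := by
  rw [← eRk_inter_ground, ← M.eRk_inter_ground X, mapEquiv_ground_eq,
    ← Set.image_inter φ.injective, mapEquiv_eq_map, eRk_map _ _ Set.inter_subset_right]

lemma mapEquiv_dual : (M.mapEquiv φ)✶ = M✶.mapEquiv φ := by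
  rw [mapEquiv_eq_map, mapEquiv_eq_map, map_dual]

lemma mapEquiv_restrict (X : Set α) : M.mapEquiv φ ↾ (φ '' X) = (M ↾ X).mapEquiv φ := by
  refine ext_indep rfl fun I _ => ?_
  rw [restrict_indep_iff, mapEquiv_indep_iff, mapEquiv_indep_iff, restrict_indep_iff,
    Equiv.symm_image_subset]

variable {M φ} {X : Set α}

lemma mapEquiv_isSeparator_iff : (M.mapEquiv φ).IsSeparator (φ '' X) ↔ M.IsSeparator X := by
  rw [IsSeparator, IsSeparator, mapEquiv_ground_eq, ← Set.image_sdiff φ.injective,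
    eRk_mapEquiv, eRk_mapEquiv, eRk_mapEquiv, Set.image_subset_image_iff φ.injective]

lemma mapEquiv_twoConnected_iff : (M.mapEquiv φ).TwoConnected ↔ M.TwoConnected := by
  rw [TwoConnected, (Set.image_surjective.2 φ.surjective).forall]
  simp only [mapEquiv_isSeparator_iff, mapEquiv_ground_eq, Set.image_eq_empty,
    Set.image_eq_image φ.injective]
  rfl

lemma mapEquiv_mem_components_iff : φ '' X ∈ (M.mapEquiv φ).components ↔ X ∈ M.components := by
  rw [mem_components_iff, mem_components_iff, Minimal, Minimal,
    (Set.image_surjective.2 φ.surjective).forall]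
  simp [mapEquiv_isSeparator_iff, Set.image_subset_image_iff φ.injective]

lemma mapEquiv_isLockedConnected_iff :
    (M.mapEquiv φ).IsLockedConnected (φ '' X) ↔ M.IsLockedConnected X := by
  rw [IsLockedConnected, IsLockedConnected, mapEquiv_dual, mapEquiv_ground_eq,
    ← Set.image_sdiff φ.injective, mapEquiv_restrict, mapEquiv_restrict, mapEquiv_twoConnected_iff,
    mapEquiv_twoConnected_iff, eRk_mapEquiv, eRk_mapEquiv, Set.image_subset_image_iff φ.injective]

lemma mapEquiv_mem_lockedSubsets_iff :
    φ '' X ∈ (M.mapEquiv φ).lockedSubsets ↔ X ∈ M.lockedSubsets := by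
  change (∃ C, _ ∧ _) ↔ ∃ C, _ ∧ _
  rw [(Set.image_surjective.2 φ.surjective).exists]
  simp only [mapEquiv_mem_components_iff, mapEquiv_restrict, mapEquiv_isLockedConnected_iff]

lemma mapEquiv_mem_parallelClosures_iff :
    φ '' X ∈ (M.mapEquiv φ).parallelClosures ↔ X ∈ M.parallelClosures := by
  have hc : ∀ Y : Set α, (M.mapEquiv φ).IsCircuit (φ '' Y) ↔ M.IsCircuit Y := by
    intro Y
    rw [isCircuit_iff, isCircuit_iff, (Set.image_surjective.2 φ.surjective).forall]
    simp [Set.image_subset_image_iff φ.injective, Set.image_eq_image φ.injective]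
  change (∃ e, _ ∧ _) ↔ ∃ e, _ ∧ _
  rw [φ.surjective.exists]
  refine exists_congr fun e => and_congr (by simp) ?_
  rw [← Set.image_eq_image φ.injective]
  refine Eq.congr_right ?_
  ext y
  obtain ⟨f, rfl⟩ := φ.surjective y
  have := hc {e, f}
  rw [Set.image_pair] at this
  simp [this, and_or_left]

lemma mapEquiv_mem_family_iff (κ : SetKind) :
    φ '' X ∈ κ.family (M.mapEquiv φ) ↔ X ∈ κ.family M := by
  cases κ with
  | component => exact mapEquiv_mem_components_iff
  | parallel => exact mapEquiv_mem_parallelClosures_iff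
  | coparallel =>
    change _ ∈ (M.mapEquiv φ)✶.parallelClosures ↔ _ ∈ M✶.parallelClosures
    rw [mapEquiv_dual, mapEquiv_mem_parallelClosures_iff]
  | locked => exact mapEquiv_mem_lockedSubsets_iff

end Map

end Matroid

/-! ### Isomorphism of locked structures -/

/-- The entries of a table in the order of its encoding, each with its kind. -/
def LockedTable.entryList {n : ℕ} (T : LockedTable n) : List (SetKind × Finset (Fin n) × ℕ) :=
  (T.entries .component).map (Prod.mk .component) ++
    (T.entries .parallel).map (Prod.mk .parallel) ++
    (T.entries .coparallel).map (Prod.mk .coparallel) ++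
    (T.entries .locked).map (Prod.mk .locked)

namespace LockedTable

variable {n n' : ℕ} {T : LockedTable n} {T' : LockedTable n'}

lemma mem_entryList {x : SetKind × Finset (Fin n) × ℕ} :
    x ∈ T.entryList ↔ x.2 ∈ T.entries x.1 := by
  obtain ⟨κ, X, r⟩ := x
  cases κ <;> simp [entryList]

lemma nodup_entryList (h : ∀ κ, (T.entries κ).Nodup) : T.entryList.Nodup := by
  have hm : ∀ κ, ((T.entries κ).map (Prod.mk κ)).Nodup :=
    fun κ => (h κ).map (Prod.mk_right_injective κ)
  simp only [entryList, List.nodup_append, hm, true_and, List.mem_append, List.mem_map]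
  grind

/-- Renaming the elements in an entry. -/
def mapEntry (φ : Fin n ≃ Fin n') :
    SetKind × Finset (Fin n) × ℕ ≃ SetKind × Finset (Fin n') × ℕ :=
  (Equiv.refl _).prodCongr (φ.finsetCongr.prodCongr (Equiv.refl _))

lemma mapEntry_apply (φ : Fin n ≃ Fin n') (κ : SetKind) (X : Finset (Fin n)) (r : ℕ) :
    mapEntry φ (κ, X, r) = (κ, X.map φ.toEmbedding, r) := rfl

/-- A bijection of the ground sets is an isomorphism of tables if it carries the entries of one
table to the entries of the other. -/
def IsIso (T : LockedTable n) (T' : LockedTable n') (φ : Fin n ≃ Fin n') : Prop :=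
  ∀ x, x ∈ T.entryList ↔ mapEntry φ x ∈ T'.entryList

lemma Represents.mem_entryList_iff {M : Matroid (Fin n)} (h : T.Represents M) {κ : SetKind}
    {X : Finset (Fin n)} {r : ℕ} :
    (κ, X, r) ∈ T.entryList ↔ (X : Set (Fin n)) ∈ κ.family M ∧ r = M.natRk X := by
  rw [mem_entryList, (h κ).2, ← Matroid.coe_natRk]
  exact_mod_cast Iff.rfl

lemma Represents.nodup_entryList {M : Matroid (Fin n)} (h : T.Represents M) :
    T.entryList.Nodup :=
  LockedTable.nodup_entryList fun κ => (h κ).1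

lemma Represents.mem_family_iff {M : Matroid (Fin n)} {M' : Matroid (Fin n')}
    (h : T.Represents M) (h' : T'.Represents M') {φ : Fin n ≃ Fin n'} (hφ : T.IsIso T' φ)
    (κ : SetKind) (X : Set (Fin n)) :
    X ∈ κ.family M ↔ φ '' X ∈ κ.family M' := by
  obtain ⟨X, rfl⟩ := X.toFinite.exists_finset_coe
  have h1 := hφ (κ, X, M.natRk X)
  have h2 := hφ (κ, X, M'.natRk (φ '' X))
  rw [mapEntry_apply, h.mem_entryList_iff, h'.mem_entryList_iff, Finset.coe_map] at h1 h2
  simp only [Equiv.coe_toEmbedding] at h1 h2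
  tauto

lemma Represents.natRk_eq {M : Matroid (Fin n)} {M' : Matroid (Fin n')}
    (h : T.Represents M) (h' : T'.Represents M') {φ : Fin n ≃ Fin n'} (hφ : T.IsIso T' φ)
    {κ : SetKind} {X : Set (Fin n)} (hX : X ∈ κ.family M) :
    M'.natRk (φ '' X) = M.natRk X := by
  obtain ⟨X, rfl⟩ := X.toFinite.exists_finset_coe
  have h1 := hφ (κ, X, M.natRk X)
  rw [mapEntry_apply, h.mem_entryList_iff, h'.mem_entryList_iff, Finset.coe_map] at h1
  exact (h1.1 ⟨hX, rfl⟩).2.symm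

end LockedTable

/-- Two matroids are isomorphic exactly when their locked structures are. -/
theorem FiniteMatroid.isomorphic_iff_exists_isIso {M N : FiniteMatroid} {T : LockedTable M.n}
    {T' : LockedTable N.n} (h : T.Represents M.matroid) (h' : T'.Represents N.matroid) :
    M.Isomorphic N ↔ ∃ φ, T.IsIso T' φ := by
  constructor
  · rintro ⟨φ, hφ⟩
    have hN : N.matroid = M.matroid.mapEquiv φ := by
      refine Matroid.ext_isBase ?_ fun B _ => ?_
      · rw [Matroid.mapEquiv_ground_eq, M.ground_eq, N.ground_eq, Set.image_univ,
          φ.surjective.range_eq]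
      · rw [Matroid.mapEquiv_isBase_iff, hφ, ← Set.image_comp]
        simp
    refine ⟨φ, fun ⟨κ, X, r⟩ => ?_⟩
    rw [LockedTable.mapEntry_apply, h.mem_entryList_iff, h'.mem_entryList_iff, Finset.coe_map,
      Equiv.coe_toEmbedding, hN, Matroid.mapEquiv_mem_family_iff, Matroid.natRk, Matroid.natRk,
      Matroid.eRk_mapEquiv]
  · rintro ⟨φ, hφ⟩
    refine ⟨φ, fun B => ?_⟩
    have hfam := h.mem_family_iff h' hφ
    have hsurj := Set.image_surjective.2 φ.surjective
    rw [Matroid.isBase_iff_of_lockedStructure, Matroid.isBase_iff_of_lockedStructure]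
    refine and_congr (by simp [M.ground_eq, N.ground_eq]) (and_congr ?_ (and_congr ?_
      (and_congr ?_ ?_)))
    · rw [hsurj.forall]
      refine forall_congr' fun C => imp_congr_ctx (hfam .component C) fun hC => ?_
      rw [← Set.image_inter φ.injective, Set.ncard_image_of_injective _ φ.injective,
        h.natRk_eq h' hφ (κ := .component) ((hfam .component C).2 hC)]
    · rw [hsurj.forall]
      refine forall_congr' fun P => imp_congr (hfam .parallel P) ?_
      rw [← Set.image_inter φ.injective, Set.ncard_image_of_injective _ φ.injective]
    · rw [hsurj.forall]
      refine forall_congr' fun S => imp_congr (hfam .coparallel S) ?_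
      rw [← Set.image_sdiff φ.injective, Set.ncard_image_of_injective _ φ.injective]
    · rw [hsurj.forall]
      refine forall_congr' fun L => imp_congr_ctx (hfam .locked L) fun hL => ?_
      rw [← Set.image_inter φ.injective, Set.ncard_image_of_injective _ φ.injective,
        h.natRk_eq h' hφ (κ := .locked) ((hfam .locked L).2 hL)]

/-! ### The size of a locked structure -/

namespace Matroid

variable {n : ℕ} (M : Matroid (Fin n))

lemma ncard_le_of_subset_range {β : Type*} {S : Set β} (f : Fin n → β) (h : S ⊆ Set.range f) :
    S.ncard ≤ n := by
  refine (Set.ncard_le_ncard h (Set.finite_range f)).trans ?_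
  rw [← Set.image_univ]
  exact (Set.ncard_image_le Set.finite_univ).trans (by simp [Set.ncard_univ])

lemma ncard_components_le : M.components.ncard ≤ n := by
  refine ncard_le_of_subset_range (fun e => {f | ∃ D ∈ M.components, e ∈ D ∧ f ∈ D}) ?_
  intro C hC
  obtain ⟨e, he⟩ := component_nonempty hC
  refine ⟨e, Set.ext fun f => ⟨?_, fun hf => ⟨C, hC, he, hf⟩⟩⟩
  rintro ⟨D, hD, heD, hf⟩
  exact components_eq_of_mem hD hC heD he ▸ hf

lemma ncard_parallelClosures_le : M.parallelClosures.ncard ≤ n := by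
  refine ncard_le_of_subset_range (fun e => {f ∈ M.E | f = e ∨ M.IsCircuit {e, f}}) ?_
  rintro P ⟨e, -, rfl⟩
  exact ⟨e, rfl⟩

end Matroid

namespace LockedTable

variable {n : ℕ} {T : LockedTable n} {M : Matroid (Fin n)}

lemma Represents.length_entries_le (h : T.Represents M) (κ : SetKind) :
    (T.entries κ).length ≤ (κ.family M).ncard := by
  classical
  rw [← List.toFinset_card_of_nodup (h κ).1, ← Set.ncard_coe_finset]
  refine Set.ncard_le_ncard_of_injOn (fun p => (p.1 : Set (Fin n))) ?_ ?_ (Set.toFinite _)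
  · rintro ⟨X, r⟩ hp
    exact (((h κ).2 X r).1 (by simpa using hp)).1
  · rintro ⟨X, r⟩ hp ⟨Y, s⟩ hq hXY
    obtain rfl : X = Y := Finset.coe_injective hXY
    have h1 := (((h κ).2 X r).1 (by simpa using hp)).2
    have h2 := (((h κ).2 X s).1 (by simpa using hq)).2
    have h3 : r = s := by exact_mod_cast h1.trans h2.symm
    rw [h3]

lemma Represents.length_entryList_le (h : T.Represents M) :
    T.entryList.length ≤ 3 * n + M.lockedNumber := by
  have h1 := h.length_entries_le .component
  have h2 := h.length_entries_le .parallel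
  have h3 := h.length_entries_le .coparallel
  have h4 := h.length_entries_le .locked
  have h5 := M.ncard_components_le
  have h6 := M.ncard_parallelClosures_le
  have h7 := M✶.ncard_parallelClosures_le
  change _ ≤ M.components.ncard at h1
  change _ ≤ M.parallelClosures.ncard at h2
  change _ ≤ M✶.parallelClosures.ncard at h3
  change _ ≤ M.lockedNumber at h4
  simp only [entryList, List.length_append, List.length_map]
  omega

lemma Represents.rank_le (h : T.Represents M) {x : SetKind × Finset (Fin n) × ℕ}
    (hx : x ∈ T.entryList) : x.2.2 ≤ n := by
  obtain ⟨κ, X, r⟩ := x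
  rw [(h.mem_entryList_iff.1 hx).2]
  refine (M.natRk_le_ncard _).trans ?_
  rw [Set.ncard_coe_finset]
  exact (Finset.card_le_univ X).trans (by simp)

/-- Every element is contained in at least two entries: its parallel and its coparallel
closure. -/
lemma Represents.exists_two_entries (h : T.Represents M) {e : Fin n} (he : e ∈ M.E) :
    ∃ x ∈ T.entryList, ∃ y ∈ T.entryList, x ≠ y ∧ e ∈ x.2.1 ∧ e ∈ y.2.1 := by
  classical
  obtain ⟨P, hP, heP, -⟩ := Matroid.exists_mem_parallelClosure he
  obtain ⟨S, hS, heS, -⟩ := Matroid.exists_mem_parallelClosure (M := M✶) he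
  obtain ⟨P, rfl⟩ := P.toFinite.exists_finset_coe
  obtain ⟨S, rfl⟩ := S.toFinite.exists_finset_coe
  exact ⟨(.parallel, P, _), h.mem_entryList_iff.2 ⟨hP, rfl⟩, (.coparallel, S, _),
    h.mem_entryList_iff.2 ⟨hS, rfl⟩, by simp, heP, heS⟩

end LockedTable

/-! ### The graph of a table, computed symbol by symbol -/

/-- The number of pendant vertices that mark an entry of the given kind and of rank `0`. All values
are at least two, and they are distinct modulo `4`. -/
def SetKind.pendants : SetKind → ℕ
  | .component => 2
  | .parallel => 3
  | .coparallel => 4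
  | .locked => 5

/-- The number of pendant vertices of an entry, which determines its kind and its rank. -/
def entryWeight {n : ℕ} (x : SetKind × Finset (Fin n) × ℕ) : ℕ := x.1.pendants + 4 * x.2.2

lemma SetKind.two_le_pendants (κ : SetKind) : 2 ≤ κ.pendants := by cases κ <;> decide

lemma SetKind.pendants_le (κ : SetKind) : κ.pendants ≤ 5 := by cases κ <;> decide

lemma SetKind.pendants_add_injective {κ κ' : SetKind} {r r' : ℕ}
    (h : κ.pendants + 4 * r = κ'.pendants + 4 * r') : κ = κ' ∧ r = r' := by
  cases κ <;> cases κ' <;> simp only [SetKind.pendants, true_and, reduceCtorEq, false_and] at * <;>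
    omega

/-- The state of the construction of the graph of a table: the number `fresh` of vertices used so
far, the vertex `cur` of the current entry, the position `pos` in its characteristic vector, and
the arcs found so far, the latest one first. -/
@[ext] structure Layout where
  fresh : ℕ
  cur : ℕ
  pos : ℕ
  arcs : List (ℕ × ℕ)

namespace Layout

/-- Attach a new pendant vertex to the current entry. -/
def addPendant (s : Layout) : Layout :=
  { s with fresh := s.fresh + 1, arcs := (s.fresh, s.cur) :: s.arcs }

/-- A new vertex for an entry. -/
def newEntry (s : Layout) : Layout :=
  { s with fresh := s.fresh + 1, cur := s.fresh, pos := 0 }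

/-- Process one symbol of a table. An element of the ground set is a vertex; an entry is a vertex
with arcs to its elements and with pendant vertices for its kind and its rank. -/
def step (s : Layout) : TableSymbol → Layout
  | .element => { s with fresh := s.fresh + 1 }
  | .kind κ => addPendant^[κ.pendants] s.newEntry
  | .bit true => { s with pos := s.pos + 1, arcs := (s.cur, s.pos) :: s.arcs }
  | .bit false => { s with pos := s.pos + 1 }
  | .rank => addPendant^[4] s
  | .endMark => s

/-- The state at the start. -/
def initial : Layout := ⟨0, 0, 0, []⟩

lemma addPendant_iterate (k : ℕ) (s : Layout) :
    (addPendant^[k] s).fresh = s.fresh + k ∧ (addPendant^[k] s).cur = s.cur ∧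
      (addPendant^[k] s).pos = s.pos ∧ ∀ a, a ∈ (addPendant^[k] s).arcs ↔
        a ∈ s.arcs ∨ ∃ t < k, a = (s.fresh + t, s.cur) := by
  induction k with
  | zero => simp
  | succ k ih =>
    obtain ⟨h1, h2, h3, h4⟩ := ih
    rw [Function.iterate_succ_apply']
    refine ⟨by simp [addPendant, h1, add_assoc], by simp [addPendant, h2],
      by simp [addPendant, h3], fun a => ?_⟩
    simp only [addPendant, List.mem_cons, h1, h2, h4, Nat.lt_succ_iff_lt_or_eq, or_and_right,
      exists_or, exists_eq_left]
    exact or_comm.trans or_assoc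

lemma foldl_rank (r : ℕ) (s : Layout) :
    (List.replicate r TableSymbol.rank).foldl step s = addPendant^[4 * r] s := by
  induction r generalizing s with
  | zero => rfl
  | succ r ih =>
    rw [List.replicate_succ, List.foldl_cons, ih, Nat.mul_succ, Function.iterate_add_apply]
    rfl

lemma foldl_element (n : ℕ) (s : Layout) :
    (List.replicate n TableSymbol.element).foldl step s = { s with fresh := s.fresh + n } := by
  induction n generalizing s with
  | zero => rfl
  | succ n ih =>
    rw [List.replicate_succ, List.foldl_cons, ih]
    simp [step, add_assoc, add_comm n]

lemma foldl_bit (l : List Bool) (s : Layout) :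
    ((l.map TableSymbol.bit).foldl step s).fresh = s.fresh ∧
    ((l.map TableSymbol.bit).foldl step s).cur = s.cur ∧
    ∀ a, a ∈ ((l.map TableSymbol.bit).foldl step s).arcs ↔
      a ∈ s.arcs ∨ ∃ i, l[i]? = some true ∧ a = (s.cur, s.pos + i) := by
  induction l generalizing s with
  | nil => simp
  | cons b l ih =>
    rw [List.map_cons, List.foldl_cons]
    obtain ⟨h1, h2, h3⟩ := ih (step s (.bit b))
    have hc : (step s (.bit b)).cur = s.cur := by cases b <;> rfl
    have hp : (step s (.bit b)).pos = s.pos + 1 := by cases b <;> rfl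
    have hf : (step s (.bit b)).fresh = s.fresh := by cases b <;> rfl
    refine ⟨h1.trans hf, h2.trans hc, fun a => ?_⟩
    rw [h3, hc, hp]
    have ha : a ∈ (step s (.bit b)).arcs ↔ a ∈ s.arcs ∨ (b = true ∧ a = (s.cur, s.pos)) := by
      cases b <;> simp [step, or_comm]
    rw [ha, or_assoc]
    refine or_congr_right ⟨?_, ?_⟩
    · rintro (⟨rfl, h⟩ | ⟨i, hi, h⟩)
      · exact ⟨0, by simp, h⟩
      · exact ⟨i + 1, by simpa using hi, by rw [h, add_assoc, add_comm 1]⟩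
    · rintro ⟨i | i, hi, h⟩
      · exact .inl ⟨by simpa using hi, h⟩
      · exact .inr ⟨i, by simpa using hi, by rw [h, add_assoc, add_comm 1]⟩

lemma foldl_encodeEntry {n : ℕ} (x : SetKind × Finset (Fin n) × ℕ) (s : Layout) :
    ((encodeEntry x.1 x.2).foldl step s).fresh = s.fresh + 1 + entryWeight x ∧
    ∀ a, a ∈ ((encodeEntry x.1 x.2).foldl step s).arcs ↔ a ∈ s.arcs ∨
      (∃ t < entryWeight x, a = (s.fresh + 1 + t, s.fresh)) ∨
      ∃ e ∈ x.2.1, a = (s.fresh, (e : ℕ)) := by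
  obtain ⟨κ, X, r⟩ := x
  rw [encodeEntry, List.foldl_cons, List.foldl_append, foldl_rank]
  have hb : (List.finRange n).map (fun e => TableSymbol.bit (decide (e ∈ X))) =
      ((List.finRange n).map fun e => decide (e ∈ X)).map TableSymbol.bit := by simp
  rw [hb]
  obtain ⟨f1, c1, p1, a1⟩ := addPendant_iterate κ.pendants s.newEntry
  obtain ⟨f2, c2, a2⟩ := foldl_bit ((List.finRange n).map fun e => decide (e ∈ X))
    (s.step (.kind κ))
  obtain ⟨f3, c3, p3, a3⟩ := addPendant_iterate (4 * r)
    ((((List.finRange n).map fun e => decide (e ∈ X)).map TableSymbol.bit).foldl step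
      (s.step (.kind κ)))
  change (s.step (.kind κ)).fresh = _ at f1
  change (s.step (.kind κ)).cur = _ at c1
  change (s.step (.kind κ)).pos = _ at p1
  change ∀ a, a ∈ (s.step (.kind κ)).arcs ↔ _ at a1
  change _ = s.fresh + 1 + _ at f1
  change _ = s.fresh at c1
  change _ = 0 at p1
  refine ⟨by simp only [f3, f2, f1, entryWeight]; omega, fun a => ?_⟩
  rw [a3, a2, a1, f2, f1, c2, c1, p1, or_assoc, or_assoc]
  refine or_congr Iff.rfl ⟨?_, ?_⟩
  · rintro (⟨t, ht, rfl⟩ | ⟨i, hi, rfl⟩ | ⟨t, ht, rfl⟩)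
    · exact .inl ⟨t, by simp only [entryWeight]; omega, rfl⟩
    · simp only [List.getElem?_map, Option.map_eq_some_iff, decide_eq_true_eq] at hi
      obtain ⟨e, he, heX⟩ := hi
      obtain ⟨hi', rfl⟩ := List.getElem?_eq_some_iff.1 he
      exact .inr ⟨_, heX, by simp⟩
    · exact .inl ⟨κ.pendants + t, by simp only [entryWeight]; omega, by rw [← add_assoc]⟩
  · rintro (⟨t, ht, rfl⟩ | ⟨e, he, rfl⟩)
    · by_cases h : t < κ.pendants
      · exact .inl ⟨t, h, rfl⟩
      · refine .inr (.inr ⟨t - κ.pendants, ?_, ?_⟩)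
        · simp only [entryWeight] at ht; omega
        · exact Prod.ext (by simp only; omega) rfl
    · refine .inr (.inl ⟨e, ?_, by simp⟩)
      simp only [List.getElem?_map, Option.map_eq_some_iff, decide_eq_true_eq]
      exact ⟨e, by simp, he⟩

end Layout

/-- The total number of vertices of a list of entries. -/
def entriesSize {n : ℕ} (l : List (SetKind × Finset (Fin n) × ℕ)) : ℕ :=
  (l.map fun x => 1 + entryWeight x).sum

/-- The vertex of the entry `x` of a list, if `b` is the vertex of the first entry. -/
def entryVertex {n : ℕ} (b : ℕ) :
    List (SetKind × Finset (Fin n) × ℕ) → SetKind × Finset (Fin n) × ℕ → ℕ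
  | [], _ => b
  | y :: l, x => if x = y then b else entryVertex (b + 1 + entryWeight y) l x

section Entries

variable {n : ℕ} {l : List (SetKind × Finset (Fin n) × ℕ)} {x y : SetKind × Finset (Fin n) × ℕ}
  {b : ℕ}

lemma entriesSize_cons : entriesSize (y :: l) = 1 + entryWeight y + entriesSize l := by
  simp [entriesSize]

lemma le_entryVertex : b ≤ entryVertex b l x := by
  induction l generalizing b with
  | nil => exact le_rfl
  | cons y l ih =>
    rw [entryVertex]
    split_ifs
    · exact le_rfl
    · exact le_trans (by omega) ih

lemma entryVertex_add_lt (hx : x ∈ l) :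
    entryVertex b l x + entryWeight x < b + entriesSize l := by
  induction l generalizing b with
  | nil => simp at hx
  | cons y l ih =>
    rw [entryVertex, entriesSize_cons]
    split_ifs with h
    · subst h; omega
    · have := ih (b := b + 1 + entryWeight y) (by simpa [h] using hx)
      omega

/-- Distinct entries use disjoint intervals of vertices. -/
lemma eq_of_entryVertex_add_eq (hx : x ∈ l) (hy : y ∈ l) {s t : ℕ} (hs : s ≤ entryWeight x)
    (ht : t ≤ entryWeight y) (h : entryVertex b l x + s = entryVertex b l y + t) :
    x = y ∧ s = t := by
  induction l generalizing b with
  | nil => simp at hx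
  | cons z l ih =>
    rw [entryVertex, entryVertex] at h
    split_ifs at h with h1 h2 h2
    · exact ⟨h1.trans h2.symm, by omega⟩
    · have := le_entryVertex (b := b + 1 + entryWeight z) (l := l) (x := y)
      subst h1; omega
    · have := le_entryVertex (b := b + 1 + entryWeight z) (l := l) (x := x)
      subst h2; omega
    · exact ih (by simpa [h1] using hx) (by simpa [h2] using hy) h

lemma exists_entryVertex_add_eq (hl : l.Nodup) {v : ℕ} (hb : b ≤ v) (hv : v < b + entriesSize l) :
    ∃ x ∈ l, ∃ t ≤ entryWeight x, v = entryVertex b l x + t := by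
  induction l generalizing b with
  | nil => simp [entriesSize] at hv; omega
  | cons y l ih =>
    rw [entriesSize_cons] at hv
    by_cases h : v ≤ b + entryWeight y
    · exact ⟨y, by simp, v - b, by omega, by rw [entryVertex, if_pos rfl]; omega⟩
    · obtain ⟨x, hx, t, ht, hvx⟩ := ih (List.nodup_cons.1 hl).2 (b := b + 1 + entryWeight y)
        (by omega) (by omega)
      have hxy : x ≠ y := ne_of_mem_of_not_mem hx (List.nodup_cons.1 hl).1
      exact ⟨x, by simp [hx], t, ht, by rw [entryVertex, if_neg hxy, hvx]⟩

lemma Layout.foldl_entries (hl : l.Nodup) (s : Layout) :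
    ((l.flatMap fun x => encodeEntry x.1 x.2).foldl step s).fresh = s.fresh + entriesSize l ∧
    ∀ a, a ∈ ((l.flatMap fun x => encodeEntry x.1 x.2).foldl step s).arcs ↔ a ∈ s.arcs ∨
      ∃ x ∈ l, (∃ t < entryWeight x,
          a = (entryVertex s.fresh l x + 1 + t, entryVertex s.fresh l x)) ∨
        ∃ e ∈ x.2.1, a = (entryVertex s.fresh l x, (e : ℕ)) := by
  induction l generalizing s with
  | nil => simp [entriesSize]
  | cons y l ih =>
    obtain ⟨hy, hl⟩ := List.nodup_cons.1 hl
    rw [List.flatMap_cons, List.foldl_append]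
    obtain ⟨f1, a1⟩ := foldl_encodeEntry y s
    obtain ⟨f2, a2⟩ := ih hl ((encodeEntry y.1 y.2).foldl step s)
    refine ⟨by rw [f2, f1, entriesSize_cons]; omega, fun a => ?_⟩
    have hne : ∀ x ∈ l, entryVertex s.fresh (y :: l) x =
        entryVertex (s.fresh + 1 + entryWeight y) l x := fun x hx => by
      rw [entryVertex, if_neg (ne_of_mem_of_not_mem hx hy)]
    have heq : entryVertex s.fresh (y :: l) y = s.fresh := by rw [entryVertex, if_pos rfl]
    rw [a2, a1, f1, or_assoc, List.exists_mem_cons_iff, heq]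
    refine or_congr_right (or_congr_right (exists_congr fun x => and_congr_right fun hx => ?_))
    rw [hne x hx]

end Entries

/-! ### The graph of a table, described by its vertices -/

/-- The vertices of the graph of a list of entries: the elements of the ground set, and for every
entry `x` its own vertex `⟨x, 0⟩` and its pendant vertices `⟨x, t⟩`, `t ≠ 0`. -/
abbrev TableVertex {n : ℕ} (l : List (SetKind × Finset (Fin n) × ℕ)) : Type :=
  Fin n ⊕ Σ x : {x // x ∈ l}, Fin (entryWeight x.1 + 1)

namespace TableVertex

variable {n n' : ℕ} {l : List (SetKind × Finset (Fin n) × ℕ)}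
  {l' : List (SetKind × Finset (Fin n') × ℕ)}

/-- The vertex of an entry. -/
def entry (x : {x // x ∈ l}) : TableVertex l := .inr ⟨x, 0⟩

/-- The arcs: from every entry to its elements, and from its pendant vertices to the entry. -/
def Arc : TableVertex l → TableVertex l → Prop
  | .inr ⟨x, t⟩, .inl e => t = 0 ∧ e ∈ x.1.2.1
  | .inr ⟨x, t⟩, .inr ⟨y, s⟩ => x = y ∧ t ≠ 0 ∧ s.val = 0
  | .inl _, _ => False

/-- The number of a vertex. -/
def number : TableVertex l → ℕ
  | .inl e => e
  | .inr ⟨x, t⟩ => entryVertex n l x.1 + t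

lemma number_lt (v : TableVertex l) : number v < n + entriesSize l := by
  rcases v with e | ⟨x, t⟩
  · exact e.2.trans_le (Nat.le_add_right _ _)
  · have := entryVertex_add_lt (b := n) x.2
    have := t.2
    simp only [number]
    omega

lemma number_injective : Function.Injective (number (l := l)) := by
  rintro (e | ⟨x, t⟩) (f | ⟨y, s⟩) h
  · exact congrArg _ (Fin.ext h)
  · have := le_entryVertex (b := n) (l := l) (x := y)
    have := e.2
    simp only [number] at h
    omega
  · have := le_entryVertex (b := n) (l := l) (x := x)
    have := f.2
    simp only [number] at h
    omega
  · obtain ⟨h1, h2⟩ := eq_of_entryVertex_add_eq x.2 y.2 (Nat.lt_succ_iff.1 t.2)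
      (Nat.lt_succ_iff.1 s.2) h
    obtain ⟨x, hx⟩ := x
    obtain ⟨y, hy⟩ := y
    subst h1
    obtain rfl := Fin.ext h2
    rfl

lemma exists_number_eq (hl : l.Nodup) {v : ℕ} (hv : v < n + entriesSize l) :
    ∃ u : TableVertex l, number u = v := by
  by_cases h : v < n
  · exact ⟨.inl ⟨v, h⟩, rfl⟩
  · obtain ⟨x, hx, t, ht, rfl⟩ := exists_entryVertex_add_eq hl (not_lt.1 h) hv
    exact ⟨.inr ⟨⟨x, hx⟩, ⟨t, Nat.lt_succ_iff.2 ht⟩⟩, rfl⟩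

/-- The numbering of the vertices. -/
noncomputable def equivFin (hl : l.Nodup) : TableVertex l ≃ Fin (n + entriesSize l) :=
  Equiv.ofBijective (fun v => ⟨number v, number_lt v⟩)
    ⟨fun _ _ h => number_injective (congrArg Fin.val h), fun v =>
      (exists_number_eq hl v.2).imp fun _ h => Fin.ext h⟩

lemma arc_iff {u v : TableVertex l} : u.Arc v ↔ ∃ x ∈ l,
    (∃ t < entryWeight x, (u.number, v.number) =
      (entryVertex n l x + 1 + t, entryVertex n l x)) ∨
    ∃ e ∈ x.2.1, (u.number, v.number) = (entryVertex n l x, (e : ℕ)) := by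
  constructor
  · intro h
    rcases u with e | ⟨x, t⟩
    · exact h.elim
    rcases v with f | ⟨y, s⟩
    · obtain ⟨rfl, hf⟩ := h
      exact ⟨x, x.2, .inr ⟨f, hf, rfl⟩⟩
    · obtain ⟨rfl, ht, hs⟩ := h
      have ht' : t.val ≠ 0 := fun h => ht (Fin.ext h)
      have := t.2
      refine ⟨x, x.2, .inl ⟨t - 1, by omega, Prod.ext ?_ ?_⟩⟩ <;> simp only [number] <;> omega
  · rintro ⟨x, hx, ⟨t, ht, h⟩ | ⟨e, he, h⟩⟩
    · obtain ⟨h1, h2⟩ := Prod.ext_iff.1 h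
      have hu : u = .inr ⟨⟨x, hx⟩, ⟨t + 1, Nat.succ_lt_succ ht⟩⟩ := number_injective (h1.trans (by
        simp only [number]; omega))
      have hv : v = entry ⟨x, hx⟩ := number_injective h2
      subst hu hv
      exact ⟨rfl, fun h => by simpa using congrArg Fin.val h, rfl⟩
    · obtain ⟨h1, h2⟩ := Prod.ext_iff.1 h
      have hu : u = entry ⟨x, hx⟩ := number_injective h1
      have hv : v = .inl e := number_injective h2
      subst hu hv
      exact ⟨rfl, he⟩

lemma Arc.number_lt {u v : TableVertex l} (h : u.Arc v) : v.number < u.number := by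
  rcases u with e | ⟨x, t⟩
  · exact h.elim
  rcases v with f | ⟨y, s⟩
  · have := le_entryVertex (b := n) (l := l) (x := x)
    have := f.2
    simp only [number]
    omega
  · obtain ⟨rfl, ht, hs⟩ := h
    have ht' : t.val ≠ 0 := fun h => ht (Fin.ext h)
    simp only [number]
    omega

/-- An isomorphism of tables extends to the vertices. -/
def congr (φ : Fin n ≃ Fin n') (h : ∀ x, x ∈ l ↔ LockedTable.mapEntry φ x ∈ l') :
    TableVertex l ≃ TableVertex l' :=
  φ.sumCongr (Equiv.sigmaCongr ((LockedTable.mapEntry φ).subtypeEquiv h) fun _ => Equiv.refl _)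

lemma congr_arc_iff {φ : Fin n ≃ Fin n'} (h : ∀ x, x ∈ l ↔ LockedTable.mapEntry φ x ∈ l')
    {u v : TableVertex l} : (congr φ h u).Arc (congr φ h v) ↔ u.Arc v := by
  rcases u with e | ⟨x, t⟩
  · exact Iff.rfl
  rcases v with f | ⟨y, s⟩
  · exact and_congr Iff.rfl (Finset.mem_map' φ.toEmbedding)
  · change (LockedTable.mapEntry φ).subtypeEquiv h x = (LockedTable.mapEntry φ).subtypeEquiv h y ∧
      _ ↔ x = y ∧ _
    rw [EmbeddingLike.apply_eq_iff_eq]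
    rfl

/-! ### Decoding the graph -/

/-- Adjacency in the underlying undirected graph. -/
def Adj (u v : TableVertex l) : Prop := u.Arc v ∨ v.Arc u

/-- Vertices with exactly one neighbour. -/
def IsLeaf (v : TableVertex l) : Prop := ∃! w, v.Adj w

lemma pendant_adj_iff {x : {x // x ∈ l}} {t : Fin (entryWeight x.1 + 1)} (ht : t ≠ 0)
    {w : TableVertex l} : Adj (.inr ⟨x, t⟩) w ↔ w = entry x := by
  constructor
  · rintro (h | h)
    · rcases w with e | ⟨y, s⟩
      · exact absurd h.1 ht
      · obtain ⟨rfl, -, hs⟩ := h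
        obtain rfl : s = 0 := Fin.ext hs
        rfl
    · rcases w with e | ⟨y, s⟩
      · exact h.elim
      · exact absurd (Fin.ext h.2.2) ht
  · rintro rfl
    exact .inl ⟨rfl, ht, rfl⟩

lemma isLeaf_pendant {x : {x // x ∈ l}} {t : Fin (entryWeight x.1 + 1)} (ht : t ≠ 0) :
    IsLeaf (.inr ⟨x, t⟩ : TableVertex l) :=
  ⟨entry x, (pendant_adj_iff ht).2 rfl, fun _ => (pendant_adj_iff ht).1⟩

lemma adj_comm {u v : TableVertex l} : u.Adj v ↔ v.Adj u := or_comm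

lemma entry_adj_pendant {x : {x // x ∈ l}} {t : Fin (entryWeight x.1 + 1)} (ht : t ≠ 0) :
    (entry x).Adj (.inr ⟨x, t⟩) :=
  adj_comm.1 ((pendant_adj_iff ht).2 rfl)

lemma two_le_entryWeight (x : SetKind × Finset (Fin n) × ℕ) : 2 ≤ entryWeight x :=
  x.1.two_le_pendants.trans (Nat.le_add_right _ _)

lemma not_isLeaf_entry (x : {x // x ∈ l}) : ¬ (entry x).IsLeaf := by
  intro h
  have hw := two_le_entryWeight x.1
  have h1 : (⟨1, by omega⟩ : Fin (entryWeight x.1 + 1)) ≠ 0 := fun h => by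
    simpa using congrArg Fin.val h
  have h2 : (⟨2, by omega⟩ : Fin (entryWeight x.1 + 1)) ≠ 0 := fun h => by
    simpa using congrArg Fin.val h
  have := h.unique (entry_adj_pendant h1) (entry_adj_pendant h2)
  simp at this

lemma element_adj_iff {e : Fin n} {w : TableVertex l} :
    Adj (.inl e) w ↔ ∃ x : {x // x ∈ l}, w = entry x ∧ e ∈ x.1.2.1 := by
  constructor
  · rintro (h | h)
    · exact h.elim
    · rcases w with f | ⟨x, t⟩
      · exact h.elim
      · obtain ⟨rfl, h⟩ := h
        exact ⟨x, rfl, h⟩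
  · rintro ⟨x, rfl, h⟩
    exact .inr ⟨rfl, h⟩

lemma entry_injective : Function.Injective (entry (l := l)) := fun x y h => by
  have : some x = some y := congrArg
    (Sum.elim (fun _ => none) fun p => some p.1 : TableVertex l → Option {x // x ∈ l}) h
  exact Option.some_injective _ this

lemma entry_adj_element {x : {x // x ∈ l}} {e : Fin n} :
    (entry x).Adj (.inl e) ↔ e ∈ x.1.2.1 := by
  rw [adj_comm, element_adj_iff]
  constructor
  · rintro ⟨y, h, he⟩
    rwa [entry_injective h]
  · exact fun h => ⟨x, rfl, h⟩

/-- The condition under which the elements can be recognized in the graph. -/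
def Covered (l : List (SetKind × Finset (Fin n) × ℕ)) : Prop :=
  ∀ e, ∃ x ∈ l, ∃ y ∈ l, x ≠ y ∧ e ∈ x.2.1 ∧ e ∈ y.2.1

lemma not_isLeaf_element (hl : Covered l) (e : Fin n) : ¬ IsLeaf (.inl e : TableVertex l) := by
  obtain ⟨x, hx, y, hy, hne, hex, hey⟩ := hl e
  intro h
  have := h.unique (element_adj_iff.2 ⟨⟨x, hx⟩, rfl, hex⟩) (element_adj_iff.2 ⟨⟨y, hy⟩, rfl, hey⟩)
  exact hne (congrArg Subtype.val (entry_injective this))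

lemma isLeaf_iff (hl : Covered l) {v : TableVertex l} :
    v.IsLeaf ↔ ∃ (x : {x // x ∈ l}) (t : Fin (entryWeight x.1 + 1)), t ≠ 0 ∧ v = .inr ⟨x, t⟩ := by
  constructor
  · intro h
    rcases v with e | ⟨x, t⟩
    · exact absurd h (not_isLeaf_element hl e)
    · refine ⟨x, t, ?_, rfl⟩
      rintro rfl
      exact not_isLeaf_entry x h
  · rintro ⟨x, t, ht, rfl⟩
    exact isLeaf_pendant ht

lemma isEntry_iff (hl : Covered l) {v : TableVertex l} :
    (¬ v.IsLeaf ∧ ∃ w, v.Adj w ∧ w.IsLeaf) ↔ ∃ x, v = entry x := by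
  constructor
  · rintro ⟨hv, w, hvw, hw⟩
    obtain ⟨x, t, ht, rfl⟩ := (isLeaf_iff hl).1 hw
    exact ⟨x, (pendant_adj_iff ht).1 (adj_comm.1 hvw)⟩
  · rintro ⟨x, rfl⟩
    have hw := two_le_entryWeight x.1
    have h1 : (⟨1, by omega⟩ : Fin (entryWeight x.1 + 1)) ≠ 0 := fun h => by
      simpa using congrArg Fin.val h
    exact ⟨not_isLeaf_entry x, _, entry_adj_pendant h1, isLeaf_pendant h1⟩

lemma isElement_iff (hl : Covered l) {v : TableVertex l} :
    (¬ v.IsLeaf ∧ ¬ ∃ w, v.Adj w ∧ w.IsLeaf) ↔ ∃ e, v = .inl e := by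
  constructor
  · rintro ⟨hv, hw⟩
    rcases v with e | ⟨x, t⟩
    · exact ⟨e, rfl⟩
    · by_cases ht : t = 0
      · subst ht
        exact absurd ((isEntry_iff hl).2 ⟨x, rfl⟩).2 hw
      · exact absurd (isLeaf_pendant ht) hv
  · rintro ⟨e, rfl⟩
    refine ⟨not_isLeaf_element hl e, fun h => ?_⟩
    obtain ⟨x, hx⟩ := (isEntry_iff hl).1 ⟨not_isLeaf_element hl e, h⟩
    exact absurd hx (by simp [entry])

/-- The number of pendant vertices of an entry can be read off the graph. -/
lemma ncard_leaves (hl : Covered l) (x : {x // x ∈ l}) :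
    {w | (entry x).Adj w ∧ w.IsLeaf}.ncard = entryWeight x.1 := by
  have : {w | (entry x).Adj w ∧ w.IsLeaf} =
      Set.range fun t : Fin (entryWeight x.1) => (.inr ⟨x, t.succ⟩ : TableVertex l) := by
    ext w
    constructor
    · rintro ⟨h, hw⟩
      obtain ⟨y, t, ht, rfl⟩ := (isLeaf_iff hl).1 hw
      obtain rfl := entry_injective ((pendant_adj_iff ht).1 (adj_comm.1 h))
      obtain ⟨s, rfl⟩ := Fin.exists_succ_eq.2 ht
      exact ⟨s, rfl⟩
    · rintro ⟨s, rfl⟩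
      exact ⟨entry_adj_pendant (Fin.succ_ne_zero s), isLeaf_pendant (Fin.succ_ne_zero s)⟩
  rw [this, ← Set.image_univ, Set.ncard_image_of_injective, Set.ncard_univ, Nat.card_fin]
  intro s t h
  simpa using h

lemma isLeaf_apply_iff {ψ : TableVertex l ≃ TableVertex l'}
    (hψ : ∀ u v, (ψ u).Adj (ψ v) ↔ u.Adj v) (v : TableVertex l) : (ψ v).IsLeaf ↔ v.IsLeaf :=
  (ψ.existsUnique_congr fun w => (hψ v w).symm).symm

lemma exists_leaf_apply_iff {ψ : TableVertex l ≃ TableVertex l'}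
    (hψ : ∀ u v, (ψ u).Adj (ψ v) ↔ u.Adj v) (v : TableVertex l) :
    (∃ w, (ψ v).Adj w ∧ w.IsLeaf) ↔ ∃ w, v.Adj w ∧ w.IsLeaf := by
  rw [ψ.surjective.exists]
  simp only [hψ, isLeaf_apply_iff hψ]

/-- An isomorphism of the undirected graphs induces an isomorphism of the tables: leaves are the
pendant vertices, entries are the other neighbours of leaves, and the remaining vertices are the
elements. -/
theorem exists_isIso_of_adj_iff (hl : Covered l) (hl' : Covered l')
    {ψ : TableVertex l ≃ TableVertex l'} (hψ : ∀ u v, (ψ u).Adj (ψ v) ↔ u.Adj v) :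
    ∃ φ : Fin n ≃ Fin n', ∀ x, x ∈ l ↔ LockedTable.mapEntry φ x ∈ l' := by
  have helt : ∀ v, (∃ f, ψ v = .inl f) ↔ ∃ e, v = .inl e := fun v => by
    rw [← isElement_iff hl, ← isElement_iff hl', isLeaf_apply_iff hψ, exists_leaf_apply_iff hψ]
  have hent : ∀ v, (∃ y, ψ v = entry y) ↔ ∃ x, v = entry x := fun v => by
    rw [← isEntry_iff hl, ← isEntry_iff hl', isLeaf_apply_iff hψ, exists_leaf_apply_iff hψ]
  choose φ hφ using fun e => (helt (.inl e)).2 ⟨e, rfl⟩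
  have hbij : Function.Bijective φ := by
    refine ⟨fun e f h => ?_, fun f => ?_⟩
    · have := (hφ e).trans ((congrArg Sum.inl h).trans (hφ f).symm)
      exact Sum.inl_injective (ψ.injective this)
    · obtain ⟨v, hv⟩ := ψ.surjective (.inl f)
      obtain ⟨e, rfl⟩ := (helt v).1 ⟨f, hv⟩
      exact ⟨e, Sum.inl_injective ((hφ e).symm.trans hv)⟩
  have hkey : ∀ (x : {x // x ∈ l}) (y : {y // y ∈ l'}), ψ (entry x) = entry y →
      y.1 = LockedTable.mapEntry (Equiv.ofBijective φ hbij) x.1 := by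
    intro x y hxy
    have hw : entryWeight y.1 = entryWeight x.1 := by
      rw [← ncard_leaves hl, ← ncard_leaves hl', ← Set.ncard_image_of_injective _ ψ.injective]
      congr 1
      ext w
      obtain ⟨w, rfl⟩ := ψ.surjective w
      rw [ψ.injective.mem_set_image]
      change _ ∧ _ ↔ _ ∧ _
      rw [← hxy, hψ, isLeaf_apply_iff hψ]
    have hmem : ∀ e, φ e ∈ y.1.2.1 ↔ e ∈ x.1.2.1 := fun e => by
      rw [← entry_adj_element, ← entry_adj_element, ← hxy, ← hφ, hψ]
    obtain ⟨⟨κ, X, r⟩, hx⟩ := x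
    obtain ⟨⟨κ', Y, r'⟩, hy⟩ := y
    obtain ⟨rfl, rfl⟩ := SetKind.pendants_add_injective hw
    rw [LockedTable.mapEntry_apply]
    refine Prod.ext rfl (Prod.ext (Finset.ext fun f => ?_) rfl)
    obtain ⟨e, rfl⟩ := hbij.2 f
    simp only at hmem ⊢
    rw [hmem]
    exact (Finset.mem_map' (Equiv.ofBijective φ hbij).toEmbedding).symm
  refine ⟨Equiv.ofBijective φ hbij, fun x => ⟨fun hx => ?_, fun hx => ?_⟩⟩
  · obtain ⟨y, hy⟩ := (hent (entry ⟨x, hx⟩)).2 ⟨_, rfl⟩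
    exact hkey _ _ hy ▸ y.2
  · obtain ⟨v, hv⟩ := ψ.surjective (entry ⟨_, hx⟩)
    obtain ⟨z, rfl⟩ := (hent v).1 ⟨_, hv⟩
    have := (LockedTable.mapEntry _).injective (hkey _ _ hv)
    exact this ▸ z.2

end TableVertex

/-! ### The graph of a locked structure -/

/-- The list of arcs with the given ends, which have to be smaller than `m`. -/
def ArcList.ofNat (m : ℕ) (l : List (ℕ × ℕ)) (h : ∀ a ∈ l, a.1 < m ∧ a.2 < m) : ArcList where
  m := m
  arcs := l.attach.map fun a => (⟨a.1.1, (h a.1 a.2).1⟩, ⟨a.1.2, (h a.1 a.2).2⟩)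

/-- The code of a list of arcs. -/
def encodeArcs (l : List (ℕ × ℕ)) : List GraphSymbol :=
  l.flatMap fun a => .arc :: (List.replicate a.1 .tail ++ List.replicate a.2 .head)

/-- The code of the graph that has been constructed in the state `s`. -/
def Layout.encode (s : Layout) : List GraphSymbol :=
  List.replicate s.fresh .vertex ++ encodeArcs s.arcs ++ [.endMark]

lemma ArcList.encode_ofNat {m : ℕ} {l : List (ℕ × ℕ)} (h : ∀ a ∈ l, a.1 < m ∧ a.2 < m) :
    (ArcList.ofNat m l h).encode = List.replicate m .vertex ++ encodeArcs l ++ [.endMark] := by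
  rw [ArcList.encode, ofNat, List.flatMap_map, encodeArcs]
  conv_rhs => rw [← l.attach_map_subtype_val, List.flatMap_map]

lemma ArcList.mem_arcs_ofNat {m : ℕ} {l : List (ℕ × ℕ)} (h : ∀ a ∈ l, a.1 < m ∧ a.2 < m)
    {u v : Fin m} : (u, v) ∈ (ArcList.ofNat m l h).arcs ↔ (u.val, v.val) ∈ l := by
  refine List.mem_map.trans ?_
  simp only [List.mem_attach, true_and, Subtype.exists, Prod.mk.injEq, Fin.ext_iff]
  constructor
  · rintro ⟨⟨a, b⟩, hab, rfl, rfl⟩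
    exact hab
  · exact fun huv => ⟨_, huv, rfl, rfl⟩

namespace LockedTable

variable {n n' : ℕ} (T : LockedTable n) {T' : LockedTable n'}

/-- The code of a table without the end mark. -/
def symbols : List TableSymbol :=
  List.replicate n .element ++ T.entryList.flatMap fun x => encodeEntry x.1 x.2

lemma encode_eq : T.encode = T.symbols ++ [.endMark] := by
  simp [encode, symbols, entryList, List.flatMap_append, List.flatMap_map]

/-- The graph of a table, as computed symbol by symbol. -/
def layout : Layout := T.symbols.foldl Layout.step Layout.initial

variable {T}

lemma layout_fresh (hT : T.entryList.Nodup) : T.layout.fresh = n + entriesSize T.entryList := by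
  rw [layout, symbols, List.foldl_append, Layout.foldl_element, (Layout.foldl_entries hT _).1]
  simp [Layout.initial]

lemma number_mem_layout_arcs (hT : T.entryList.Nodup) {u v : TableVertex T.entryList} :
    (u.number, v.number) ∈ T.layout.arcs ↔ u.Arc v := by
  rw [layout, symbols, List.foldl_append, Layout.foldl_element, (Layout.foldl_entries hT _).2,
    TableVertex.arc_iff]
  simp [Layout.initial]

lemma layout_arcs_lt (hT : T.entryList.Nodup) :
    ∀ a ∈ T.layout.arcs, a.1 < T.layout.fresh ∧ a.2 < T.layout.fresh := by
  intro a ha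
  rw [layout_fresh hT]
  rw [layout, symbols, List.foldl_append, Layout.foldl_element,
    (Layout.foldl_entries hT _).2] at ha
  simp only [Layout.initial, zero_add, List.not_mem_nil, false_or] at ha
  obtain ⟨x, hx, ⟨t, ht, rfl⟩ | ⟨e, he, rfl⟩⟩ := ha
  · have := entryVertex_add_lt (b := n) hx
    simp only
    omega
  · have := entryVertex_add_lt (b := n) hx
    have := e.2
    simp only
    omega

/-- The graph of a table without repetitions, as a list of arcs. -/
def graph (hT : T.entryList.Nodup) : ArcList :=
  ArcList.ofNat T.layout.fresh T.layout.arcs (layout_arcs_lt hT)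

/-- The numbering of the vertices of the graph of a table. -/
noncomputable def vertexEquiv (hT : T.entryList.Nodup) :
    TableVertex T.entryList ≃ Fin (graph hT).m :=
  (TableVertex.equivFin hT).trans (finCongr (layout_fresh hT).symm)

lemma graph_adj_iff (hT : T.entryList.Nodup) {u v : TableVertex T.entryList} :
    (graph hT).toDigraph.Adj (vertexEquiv hT u) (vertexEquiv hT v) ↔ u.Arc v := by
  rw [← number_mem_layout_arcs hT]
  exact ArcList.mem_arcs_ofNat _

lemma graph_isAcyclic (hT : T.entryList.Nodup) : (graph hT).toDigraph.IsAcyclic := by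
  have hlt : ∀ u v, Relation.TransGen (graph hT).toDigraph.Adj u v → v < u := by
    intro u v h
    refine Relation.TransGen.trans_induction_on (motive := fun {u v} _ => v < u) h ?_
      fun _ _ h1 h2 => h2.trans h1
    intro a b hab
    obtain ⟨a, rfl⟩ := (vertexEquiv hT).surjective a
    obtain ⟨b, rfl⟩ := (vertexEquiv hT).surjective b
    exact ((graph_adj_iff hT).1 hab).number_lt
  exact fun v h => lt_irrefl v (hlt v v h)

lemma toGraph_adj_iff (hT : T.entryList.Nodup) {u v : TableVertex T.entryList} :
    (graph hT).toGraph.Adj (vertexEquiv hT u) (vertexEquiv hT v) ↔ u.Adj v := by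
  rw [ArcList.toGraph, SimpleGraph.fromRel_adj]
  change _ ∧ ((graph hT).toDigraph.Adj _ _ ∨ (graph hT).toDigraph.Adj _ _) ↔ _
  rw [graph_adj_iff, graph_adj_iff, and_iff_right_of_imp]
  · rfl
  · rintro h heq
    obtain rfl := (vertexEquiv hT).injective heq
    exact lt_irrefl _ (h.elim (fun h => h.number_lt) fun h => h.number_lt)

/-- Isomorphic tables have isomorphic directed graphs. -/
lemma nonempty_relIso_of_isIso (hT : T.entryList.Nodup) (hT' : T'.entryList.Nodup)
    {φ : Fin n ≃ Fin n'} (hφ : T.IsIso T' φ) :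
    Nonempty ((graph hT).toDigraph.Adj ≃r (graph hT').toDigraph.Adj) := by
  refine ⟨⟨(vertexEquiv hT).symm.trans ((TableVertex.congr φ hφ).trans (vertexEquiv hT')), ?_⟩⟩
  intro a b
  obtain ⟨a, rfl⟩ := (vertexEquiv hT).surjective a
  obtain ⟨b, rfl⟩ := (vertexEquiv hT).surjective b
  simp only [Equiv.trans_apply, Equiv.symm_apply_apply, graph_adj_iff]
  exact TableVertex.congr_arc_iff hφ

/-- Tables with isomorphic undirected graphs are isomorphic. -/
lemma exists_isIso_of_iso (hT : T.entryList.Nodup) (hT' : T'.entryList.Nodup)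
    (hc : TableVertex.Covered T.entryList) (hc' : TableVertex.Covered T'.entryList)
    (ψ : (graph hT).toGraph ≃g (graph hT').toGraph) : ∃ φ, T.IsIso T' φ := by
  refine TableVertex.exists_isIso_of_adj_iff hc hc'
    (ψ := (vertexEquiv hT).trans (ψ.toEquiv.trans (vertexEquiv hT').symm)) fun u v => ?_
  rw [← toGraph_adj_iff hT', ← toGraph_adj_iff hT]
  simp only [Equiv.trans_apply, Equiv.apply_symm_apply]
  exact ψ.map_adj_iff

end LockedTable

/-- Isomorphic directed graphs have isomorphic underlying undirected graphs. -/
lemma ArcList.nonempty_iso_of_relIso {A B : ArcList} (ψ : A.toDigraph.Adj ≃r B.toDigraph.Adj) :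
    Nonempty (A.toGraph ≃g B.toGraph) := by
  refine ⟨⟨ψ.toEquiv, fun {a b} => ?_⟩⟩
  have h1 : (ψ.toEquiv a, ψ.toEquiv b) ∈ B.arcs ↔ (a, b) ∈ A.arcs := ψ.map_rel_iff
  have h2 : (ψ.toEquiv b, ψ.toEquiv a) ∈ B.arcs ↔ (b, a) ∈ A.arcs := ψ.map_rel_iff
  simp only [ArcList.toGraph, SimpleGraph.fromRel_adj, ne_eq, h1, h2,
    EmbeddingLike.apply_eq_iff_eq]

namespace GivenMatroid

variable {C : Set FiniteMatroid}

/-- The graph of a matroid given by its locked structure. -/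
def graph (x : GivenMatroid C) : ArcList := LockedTable.graph x.represents.nodup_entryList

lemma graph_isAcyclic (x : GivenMatroid C) : x.graph.toDigraph.IsAcyclic :=
  LockedTable.graph_isAcyclic _

lemma covered (x : GivenMatroid C) : TableVertex.Covered x.table.entryList := fun e =>
  x.represents.exists_two_entries (by rw [x.M.ground_eq]; exact Set.mem_univ e)

lemma encode_graph (x : GivenMatroid C) : x.graph.encode = x.table.layout.encode :=
  ArcList.encode_ofNat (LockedTable.layout_arcs_lt x.represents.nodup_entryList)

/-- Isomorphism of the matroids, of the directed graphs and of the undirected graphs are equivalent: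
each implies the next, and the last one implies the first by decoding. -/
theorem isomorphic_iff (x y : GivenMatroid C) :
    (x.M.Isomorphic y.M ↔ Nonempty (x.graph.toDigraph.Adj ≃r y.graph.toDigraph.Adj)) ∧
      (x.M.Isomorphic y.M ↔ Nonempty (x.graph.toGraph ≃g y.graph.toGraph)) := by
  have h0 := FiniteMatroid.isomorphic_iff_exists_isIso x.represents y.represents
  have h1 : x.M.Isomorphic y.M → Nonempty (x.graph.toDigraph.Adj ≃r y.graph.toDigraph.Adj) :=
    fun h => by
      obtain ⟨φ, hφ⟩ := h0.1 h
      exact LockedTable.nonempty_relIso_of_isIso _ _ hφ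
  have h2 : Nonempty (x.graph.toDigraph.Adj ≃r y.graph.toDigraph.Adj) →
      Nonempty (x.graph.toGraph ≃g y.graph.toGraph) :=
    fun ⟨ψ⟩ => ArcList.nonempty_iso_of_relIso ψ
  have h3 : Nonempty (x.graph.toGraph ≃g y.graph.toGraph) → x.M.Isomorphic y.M :=
    fun ⟨ψ⟩ => h0.2 (LockedTable.exists_isIso_of_iso _ _ x.covered y.covered ψ)
  exact ⟨⟨h1, fun h => h3 (h2 h)⟩, fun h => h2 (h1 h), h3⟩

end GivenMatroid

/-! ### A Turing machine that computes the graphs -/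

namespace GraphMachine

/-- The stacks of the machine: the input, the output, the reversed output, the arcs of the current
graph, and the counters of a `Layout` with an auxiliary counter. -/
inductive Tape
  | input
  | output
  | rev
  | arcs
  | fresh
  | cur
  | pos
  | aux
  deriving DecidableEq

instance : Fintype Tape :=
  ⟨{.input, .output, .rev, .arcs, .fresh, .cur, .pos, .aux}, by intro k; cases k <;> simp⟩

/-- The stack alphabets. A counter is a stack of identical marks. -/
def Alphabet : Tape → Type
  | .input => TableSymbol
  | .output => GraphSymbol
  | .rev => GraphSymbol
  | .arcs => GraphSymbol
  | .fresh => Unit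
  | .cur => Unit
  | .pos => Unit
  | .aux => Unit

/-- The internal state: the last symbols popped, and whether the last stack tested was nonempty. -/
structure Register where
  token : Option TableSymbol
  symbol : Option GraphSymbol
  more : Bool
  deriving DecidableEq, Fintype

/-- The internal state between two loops. -/
def blank : Register := ⟨none, none, false⟩

/-- The labels of the program. The argument of `pendants` is the number of pendant vertices
that remain to be attached, at most `5`; the argument of the four labels after it is the number that
remains after the current one. -/
inductive Label
  | read
  | dispatch (t : Option TableSymbol)
  | clearCur (κ : SetKind)
  | clearPos (κ : SetKind)
  | setCur (κ : SetKind)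
  | restoreFresh (κ : SetKind)
  | pendants (k : Fin 6)
  | pendantHead (k : Fin 6)
  | pendantHeadBack (k : Fin 6)
  | pendantTail (k : Fin 6)
  | pendantTailBack (k : Fin 6)
  | incidenceHead
  | incidenceHeadBack
  | incidenceTail
  | incidenceTailBack
  | finishFresh
  | finishArcs
  | finishCur
  | finishPos
  | reverse
  deriving DecidableEq, Fintype

/-- Program statements. -/
abbrev Statement : Type := Turing.TM2.Stmt Alphabet Label Register

open Turing.TM2.Stmt

/-- Jump to a label. -/
def jump (l : Label) : Statement := goto fun _ => l

/-- One round of a loop that empties a counter: if it is nonempty, remove a mark, perform `body` and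
repeat; otherwise continue with `exit`. -/
def loop (k : Tape) (self : Label) (body : Statement → Statement) (exit : Statement) :
    Statement :=
  pop k (fun v o => { v with more := o.isSome }) <|
    branch (fun v => v.more) (load (fun _ => blank) (body (jump self)))
      (load (fun _ => blank) exit)

/-- The instructions for a symbol of the input. -/
def dispatch : Option TableSymbol → Statement
  | none => jump .reverse
  | some .element => push .fresh (fun _ => ()) (jump .read)
  | some (.kind κ) => jump (.clearCur κ)
  | some (.bit true) => jump .incidenceHead
  | some (.bit false) => push .pos (fun _ => ()) (jump .read)
  | some .rank => jump (.pendants 4)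
  | some .endMark => jump .finishFresh

/-- The instructions at the head of the loop that attaches pendant vertices. -/
def pendants : Fin 6 → Statement
  | ⟨0, _⟩ => jump .read
  | ⟨k + 1, h⟩ => jump (.pendantHead ⟨k, Nat.lt_of_succ_lt h⟩)

/-- The program. -/
def program : Label → Statement
  | .read => pop .input (fun v o => { v with token := o }) (goto fun v => .dispatch v.token)
  | .dispatch t => load (fun _ => blank) (dispatch t)
  | .clearCur κ => loop .cur (.clearCur κ) id (jump (.clearPos κ))
  | .clearPos κ => loop .pos (.clearPos κ) id (jump (.setCur κ))
  | .setCur κ => loop .fresh (.setCur κ)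
      (fun q => push .aux (fun _ => ()) (push .cur (fun _ => ()) q)) (jump (.restoreFresh κ))
  | .restoreFresh κ => loop .aux (.restoreFresh κ) (push .fresh fun _ => ())
      (push .fresh (fun _ => ()) (jump (.pendants (Fin.ofNat 6 κ.pendants))))
  | .pendants k => pendants k
  | .pendantHead k => loop .cur (.pendantHead k)
      (fun q => push .aux (fun _ => ()) (push .arcs (fun _ => .head) q))
      (jump (.pendantHeadBack k))
  | .pendantHeadBack k => loop .aux (.pendantHeadBack k) (push .cur fun _ => ())
      (jump (.pendantTail k))
  | .pendantTail k => loop .fresh (.pendantTail k)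
      (fun q => push .aux (fun _ => ()) (push .arcs (fun _ => .tail) q))
      (jump (.pendantTailBack k))
  | .pendantTailBack k => loop .aux (.pendantTailBack k) (push .fresh fun _ => ())
      (push .arcs (fun _ => .arc) (push .fresh (fun _ => ()) (jump (.pendants k))))
  | .incidenceHead => loop .pos .incidenceHead
      (fun q => push .aux (fun _ => ()) (push .arcs (fun _ => .head) q)) (jump .incidenceHeadBack)
  | .incidenceHeadBack => loop .aux .incidenceHeadBack (push .pos fun _ => ())
      (jump .incidenceTail)
  | .incidenceTail => loop .cur .incidenceTail
      (fun q => push .aux (fun _ => ()) (push .arcs (fun _ => .tail) q)) (jump .incidenceTailBack)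
  | .incidenceTailBack => loop .aux .incidenceTailBack (push .cur fun _ => ())
      (push .arcs (fun _ => .arc) (push .pos (fun _ => ()) (jump .read)))
  | .finishFresh => loop .fresh .finishFresh (push .rev fun _ => .vertex) (jump .finishArcs)
  | .finishArcs =>
      pop .arcs (fun v o => { v with symbol := o, more := o.isSome }) <|
        branch (fun v => v.more)
          (push .rev (fun v => v.symbol.getD .endMark) (load (fun _ => blank) (jump .finishArcs)))
          (load (fun _ => blank) (push .rev (fun _ => .endMark) (jump .finishCur)))
  | .finishCur => loop .cur .finishCur id (jump .finishPos)
  | .finishPos => loop .pos .finishPos id (jump .read)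
  | .reverse =>
      pop .rev (fun v o => { v with symbol := o, more := o.isSome }) <|
        branch (fun v => v.more)
          (push .output (fun v => v.symbol.getD .endMark) (load (fun _ => blank) (jump .reverse)))
          (load (fun _ => blank) halt)

/-- The machine. -/
def machine : Turing.FinTM2 where
  K := Tape
  k₀ := .input
  k₁ := .output
  Γ := Alphabet
  Λ := Label
  main := .read
  σ := Register
  initialState := blank
  Γk₀Fin := inferInstanceAs (Fintype TableSymbol)
  m := program

/-- The contents of the stacks; a counter is given by its value. -/
structure Contents where
  input : List TableSymbol
  output : List GraphSymbol
  rev : List GraphSymbol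
  arcs : List GraphSymbol
  fresh : ℕ
  cur : ℕ
  pos : ℕ
  aux : ℕ

/-- The stacks with the given contents. -/
def Contents.stacks (s : Contents) : ∀ k : Tape, List (Alphabet k)
  | .input => s.input
  | .output => s.output
  | .rev => s.rev
  | .arcs => s.arcs
  | .fresh => List.replicate s.fresh ()
  | .cur => List.replicate s.cur ()
  | .pos => List.replicate s.pos ()
  | .aux => List.replicate s.aux ()

/-- The configuration at a label, with the internal state `blank`. -/
def cfg (l : Label) (s : Contents) : machine.Cfg := ⟨some l, blank, s.stacks⟩

/-- From `a` the machine reaches `b` within `t` steps. -/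
def Reaches (t : ℕ) (a b : machine.Cfg) : Prop :=
  Nonempty (StateTransition.EvalsToInTime machine.step a (some b) t)

variable {a b c : machine.Cfg} {s t : ℕ}

lemma Reaches.mono (h : Reaches s a b) (hst : s ≤ t) : Reaches t a b :=
  h.map fun h => ⟨h.toEvalsTo, h.steps_le_m.trans hst⟩

lemma Reaches.refl (a : machine.Cfg) : Reaches 0 a a := ⟨.refl _ _⟩

lemma Reaches.trans (h : Reaches s a b) (h' : Reaches t b c) : Reaches (s + t) a c := by
  obtain ⟨h⟩ := h
  obtain ⟨h'⟩ := h'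
  rw [add_comm]
  exact ⟨.trans _ _ _ _ _ _ h h'⟩

lemma reaches_of_step (h : machine.step a = some b) : Reaches 1 a b :=
  ⟨⟨⟨1, h⟩, le_rfl⟩⟩

lemma eq_cfg {l : Label} {s : Contents} {c : Turing.TM2.Cfg Alphabet Label Register}
    (hl : c.l = some l) (hv : c.var = blank) (hs : ∀ k, c.stk k = s.stacks k) : c = cfg l s := by
  obtain ⟨l, v, S⟩ := c
  subst hl hv
  exact congrArg _ (funext hs)

lemma reaches_of_stepAux {l l' : Label} {s s' : Contents}
    (hl : (Turing.TM2.stepAux (program l) blank s.stacks).l = some l')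
    (hv : (Turing.TM2.stepAux (program l) blank s.stacks).var = blank)
    (hs : ∀ k, (Turing.TM2.stepAux (program l) blank s.stacks).stk k = s'.stacks k) :
    Reaches 1 (cfg l s) (cfg l' s') :=
  reaches_of_step (congrArg some (eq_cfg hl hv hs))

/-- A loop that empties a counter with value `c` takes `c + 1` steps. -/
lemma reaches_loop {l : Label} (P : ℕ → ℕ → Contents) {Q : ℕ → machine.Cfg}
    (h : ∀ c a, Reaches 1 (cfg l (P (c + 1) a)) (cfg l (P c (a + 1))))
    (h' : ∀ a, Reaches 1 (cfg l (P 0 a)) (Q a)) (c : ℕ) :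
    Reaches (c + 1) (cfg l (P c 0)) (Q c) := by
  have key : ∀ a, Reaches (c + 1) (cfg l (P c a)) (Q (a + c)) := by
    induction c with
    | zero => exact fun a => (h' a)
    | succ c ih =>
      intro a
      have := (h c a).trans (ih (a + 1))
      rw [Nat.add_right_comm, add_assoc a] at this
      exact this.mono (by omega)
  simpa using key 0

/-- The contents of the stacks in the state `s` of the construction of a graph. -/
def contents (s : Layout) (inp : List TableSymbol) (rev : List GraphSymbol) : Contents :=
  ⟨inp, [], rev, encodeArcs s.arcs, s.fresh, s.cur, s.pos, 0⟩

lemma encodeArcs_cons (u v : ℕ) (l : List (ℕ × ℕ)) : encodeArcs ((u, v) :: l) =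
    .arc :: (List.replicate u .tail ++ (List.replicate v .head ++ encodeArcs l)) := by
  simp [encodeArcs]

section Simulation

variable {s : Layout} {inp : List TableSymbol} {rev : List GraphSymbol} {B : ℕ}

/-- Two loops copy `cur` and two loops copy `fresh` to the list of arcs. -/
lemma reaches_pendantHead (k : Fin 6) :
    Reaches (2 * s.cur + 2 * s.fresh + 4) (cfg (.pendantHead k) (contents s inp rev))
      (cfg (.pendants k) (contents s.addPendant inp rev)) := by
  have h1 := reaches_loop (l := .pendantHead k)
    (fun c a => { contents s inp rev with
      cur := c, aux := a, arcs := List.replicate a .head ++ encodeArcs s.arcs })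
    (Q := fun a => cfg (.pendantHeadBack k) { contents s inp rev with
      cur := 0, aux := a, arcs := List.replicate a .head ++ encodeArcs s.arcs })
    (fun c a => reaches_of_stepAux rfl rfl fun k => by cases k <;> rfl)
    (fun a => reaches_of_stepAux rfl rfl fun k => by cases k <;> rfl) s.cur
  have h2 := reaches_loop (l := .pendantHeadBack k)
    (fun c a => { contents s inp rev with
      cur := a, aux := c, arcs := List.replicate s.cur .head ++ encodeArcs s.arcs })
    (Q := fun a => cfg (.pendantTail k) { contents s inp rev with
      cur := a, aux := 0, arcs := List.replicate s.cur .head ++ encodeArcs s.arcs })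
    (fun c a => reaches_of_stepAux rfl rfl fun k => by cases k <;> rfl)
    (fun a => reaches_of_stepAux rfl rfl fun k => by cases k <;> rfl) s.cur
  have h3 := reaches_loop (l := .pendantTail k)
    (fun c a => { contents s inp rev with
      fresh := c, aux := a,
      arcs := List.replicate a .tail ++ (List.replicate s.cur .head ++ encodeArcs s.arcs) })
    (Q := fun a => cfg (.pendantTailBack k) { contents s inp rev with
      fresh := 0, aux := a,
      arcs := List.replicate a .tail ++ (List.replicate s.cur .head ++ encodeArcs s.arcs) })
    (fun c a => reaches_of_stepAux rfl rfl fun k => by cases k <;> rfl)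
    (fun a => reaches_of_stepAux rfl rfl fun k => by cases k <;> rfl) s.fresh
  have h4 := reaches_loop (l := .pendantTailBack k)
    (fun c a => { contents s inp rev with
      fresh := a, aux := c,
      arcs := List.replicate s.fresh .tail ++ (List.replicate s.cur .head ++ encodeArcs s.arcs) })
    (Q := fun a => cfg (.pendants k) { contents s inp rev with
      fresh := a + 1, aux := 0,
      arcs := .arc ::
        (List.replicate s.fresh .tail ++ (List.replicate s.cur .head ++ encodeArcs s.arcs)) })
    (fun c a => reaches_of_stepAux rfl rfl fun k => by cases k <;> rfl)
    (fun a => reaches_of_stepAux rfl rfl fun k => by cases k <;> rfl) s.fresh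
  have h := ((h1.trans h2).trans (h3.trans h4)).mono
    (by omega : _ ≤ 2 * s.cur + 2 * s.fresh + 4)
  rw [← encodeArcs_cons] at h
  exact h

lemma reaches_pendants (k : ℕ) (hk : k < 6) (hf : s.fresh + k ≤ B) (hc : s.cur ≤ B) :
    Reaches (k * (4 * B + 5) + 1) (cfg (.pendants ⟨k, hk⟩) (contents s inp rev))
      (cfg .read (contents (Layout.addPendant^[k] s) inp rev)) := by
  induction k generalizing s with
  | zero =>
    exact (reaches_of_stepAux rfl rfl fun k => by cases k <;> rfl : Reaches 1 _ _).mono (by omega)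
  | succ k ih =>
    have h1 : Reaches 1 (cfg (.pendants ⟨k + 1, hk⟩) (contents s inp rev))
        (cfg (.pendantHead ⟨k, Nat.lt_of_succ_lt hk⟩) (contents s inp rev)) :=
      reaches_of_stepAux rfl rfl fun k => by cases k <;> rfl
    have h2 := ih (s := s.addPendant) (Nat.lt_of_succ_lt hk)
      (by simp only [Layout.addPendant]; omega) hc
    exact ((h1.trans (reaches_pendantHead _)).trans h2).mono
      (by have := add_one_mul k (4 * B + 5); omega)

lemma reaches_clearCur (κ : SetKind) :
    Reaches (s.cur + s.pos + 2 * s.fresh + 4) (cfg (.clearCur κ) (contents s inp rev))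
      (cfg (.pendants (Fin.ofNat 6 κ.pendants)) (contents s.newEntry inp rev)) := by
  have h1 := reaches_loop (l := .clearCur κ)
    (fun c _ => { contents s inp rev with cur := c })
    (Q := fun _ => cfg (.clearPos κ) { contents s inp rev with cur := 0 })
    (fun c a => reaches_of_stepAux rfl rfl fun k => by cases k <;> rfl)
    (fun a => reaches_of_stepAux rfl rfl fun k => by cases k <;> rfl) s.cur
  have h2 := reaches_loop (l := .clearPos κ)
    (fun c _ => { contents s inp rev with cur := 0, pos := c })
    (Q := fun _ => cfg (.setCur κ) { contents s inp rev with cur := 0, pos := 0 })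
    (fun c a => reaches_of_stepAux rfl rfl fun k => by cases k <;> rfl)
    (fun a => reaches_of_stepAux rfl rfl fun k => by cases k <;> rfl) s.pos
  have h3 := reaches_loop (l := .setCur κ)
    (fun c a => { contents s inp rev with fresh := c, cur := a, pos := 0, aux := a })
    (Q := fun a => cfg (.restoreFresh κ)
      { contents s inp rev with fresh := 0, cur := a, pos := 0, aux := a })
    (fun c a => reaches_of_stepAux rfl rfl fun k => by cases k <;> rfl)
    (fun a => reaches_of_stepAux rfl rfl fun k => by cases k <;> rfl) s.fresh
  have h4 := reaches_loop (l := .restoreFresh κ)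
    (fun c a => { contents s inp rev with fresh := a, cur := s.fresh, pos := 0, aux := c })
    (Q := fun a => cfg (.pendants (Fin.ofNat 6 κ.pendants))
      { contents s inp rev with fresh := a + 1, cur := s.fresh, pos := 0, aux := 0 })
    (fun c a => reaches_of_stepAux rfl rfl fun k => by cases k <;> rfl)
    (fun a => reaches_of_stepAux rfl rfl fun k => by cases k <;> rfl) s.fresh
  exact ((h1.trans h2).trans (h3.trans h4)).mono (by omega)

lemma reaches_incidenceHead :
    Reaches (2 * s.pos + 2 * s.cur + 4) (cfg .incidenceHead (contents s inp rev))
      (cfg .read (contents (s.step (.bit true)) inp rev)) := by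
  have h1 := reaches_loop (l := .incidenceHead)
    (fun c a => { contents s inp rev with
      pos := c, aux := a, arcs := List.replicate a .head ++ encodeArcs s.arcs })
    (Q := fun a => cfg .incidenceHeadBack { contents s inp rev with
      pos := 0, aux := a, arcs := List.replicate a .head ++ encodeArcs s.arcs })
    (fun c a => reaches_of_stepAux rfl rfl fun k => by cases k <;> rfl)
    (fun a => reaches_of_stepAux rfl rfl fun k => by cases k <;> rfl) s.pos
  have h2 := reaches_loop (l := .incidenceHeadBack)
    (fun c a => { contents s inp rev with
      pos := a, aux := c, arcs := List.replicate s.pos .head ++ encodeArcs s.arcs })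
    (Q := fun a => cfg .incidenceTail { contents s inp rev with
      pos := a, aux := 0, arcs := List.replicate s.pos .head ++ encodeArcs s.arcs })
    (fun c a => reaches_of_stepAux rfl rfl fun k => by cases k <;> rfl)
    (fun a => reaches_of_stepAux rfl rfl fun k => by cases k <;> rfl) s.pos
  have h3 := reaches_loop (l := .incidenceTail)
    (fun c a => { contents s inp rev with
      cur := c, aux := a,
      arcs := List.replicate a .tail ++ (List.replicate s.pos .head ++ encodeArcs s.arcs) })
    (Q := fun a => cfg .incidenceTailBack { contents s inp rev with
      cur := 0, aux := a,
      arcs := List.replicate a .tail ++ (List.replicate s.pos .head ++ encodeArcs s.arcs) })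
    (fun c a => reaches_of_stepAux rfl rfl fun k => by cases k <;> rfl)
    (fun a => reaches_of_stepAux rfl rfl fun k => by cases k <;> rfl) s.cur
  have h4 := reaches_loop (l := .incidenceTailBack)
    (fun c a => { contents s inp rev with
      cur := a, aux := c,
      arcs := List.replicate s.cur .tail ++ (List.replicate s.pos .head ++ encodeArcs s.arcs) })
    (Q := fun a => cfg .read { contents s inp rev with
      cur := a, pos := s.pos + 1, aux := 0,
      arcs := .arc ::
        (List.replicate s.cur .tail ++ (List.replicate s.pos .head ++ encodeArcs s.arcs)) })
    (fun c a => reaches_of_stepAux rfl rfl fun k => by cases k <;> rfl)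
    (fun a => reaches_of_stepAux rfl rfl fun k => by cases k <;> rfl) s.cur
  have h := ((h1.trans h2).trans (h3.trans h4)).mono
    (by omega : _ ≤ 2 * s.pos + 2 * s.cur + 4)
  rw [← encodeArcs_cons] at h
  exact h

/-- Reading a symbol and jumping to the instructions for it takes two steps; `none` stands for an
empty input stack. -/
lemma reaches_read {x : Option TableSymbol} {inp' : List TableSymbol} {l : Label}
    {s' : Contents} (hi : inp'.head? = x) (hi' : inp'.tail = inp)
    (hl : (Turing.TM2.stepAux (dispatch x) blank (contents s inp rev).stacks).l = some l)
    (hv : (Turing.TM2.stepAux (dispatch x) blank (contents s inp rev).stacks).var = blank)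
    (hs : ∀ k, (Turing.TM2.stepAux (dispatch x) blank (contents s inp rev).stacks).stk k =
      s'.stacks k) :
    Reaches 2 (cfg .read (contents s inp' rev)) (cfg l s') := by
  subst hi hi'
  have h1 : machine.step (cfg .read (contents s inp' rev)) =
      some (⟨some (.dispatch inp'.head?), ⟨inp'.head?, none, false⟩,
        (contents s inp'.tail rev).stacks⟩ : Turing.TM2.Cfg Alphabet Label Register) :=
    congrArg some (congrArg (Turing.TM2.Cfg.mk _ _) (funext fun k => by cases k <;> rfl))
  exact (reaches_of_step h1).trans (reaches_of_step (congrArg some (eq_cfg hl hv hs)))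

/-- The time for one symbol is linear in the counters; the largest constant is needed for an entry
with `5` pendant vertices. -/
lemma reaches_step {x : TableSymbol} (hx : x ≠ .endMark) (hf : s.fresh + 6 ≤ B)
    (hc : s.cur + 6 ≤ B) (hp : s.pos + 6 ≤ B) :
    Reaches (32 * (B + 1)) (cfg .read (contents s (x :: inp) rev))
      (cfg .read (contents (s.step x) inp rev)) := by
  cases x with
  | endMark => exact absurd rfl hx
  | element =>
    have h : Reaches 2 (cfg .read (contents s (.element :: inp) rev))
        (cfg .read (contents (s.step .element) inp rev)) :=
      reaches_read rfl rfl rfl rfl fun k => by cases k <;> rfl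
    exact h.mono (by omega)
  | kind κ =>
    have h1 : Reaches 2 (cfg .read (contents s (.kind κ :: inp) rev))
        (cfg (.clearCur κ) (contents s inp rev)) :=
      reaches_read rfl rfl rfl rfl fun k => by cases k <;> rfl
    have h2 := reaches_clearCur (s := s) (inp := inp) (rev := rev) κ
    have hκ := κ.pendants_le
    have h3 := reaches_pendants (s := s.newEntry) (inp := inp) (rev := rev) (B := B) κ.pendants
      (by omega) (by simp only [Layout.newEntry]; omega) (by simp only [Layout.newEntry]; omega)
    have he : Fin.ofNat 6 κ.pendants = ⟨κ.pendants, by omega⟩ := by cases κ <;> rfl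
    rw [he] at h2
    refine ((h1.trans h2).trans h3).mono ?_
    have : κ.pendants * (4 * B + 5) ≤ 5 * (4 * B + 5) := Nat.mul_le_mul_right _ hκ
    omega
  | bit b =>
    cases b with
    | false =>
      have h : Reaches 2 (cfg .read (contents s (.bit false :: inp) rev))
          (cfg .read (contents (s.step (.bit false)) inp rev)) :=
        reaches_read rfl rfl rfl rfl fun k => by cases k <;> rfl
      exact h.mono (by omega)
    | true =>
      have h : Reaches 2 (cfg .read (contents s (.bit true :: inp) rev))
          (cfg .incidenceHead (contents s inp rev)) :=
        reaches_read rfl rfl rfl rfl fun k => by cases k <;> rfl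
      exact (h.trans reaches_incidenceHead).mono (by omega)
  | rank =>
    have h1 : Reaches 2 (cfg .read (contents s (.rank :: inp) rev))
        (cfg (.pendants 4) (contents s inp rev)) :=
      reaches_read rfl rfl rfl rfl fun k => by cases k <;> rfl
    have h2 := reaches_pendants (s := s) (inp := inp) (rev := rev) (B := B) 4 (by omega)
      (by omega) (by omega)
    exact (h1.trans h2).mono (by omega)

end Simulation

/-- A bound for the counters and for the length of the code of the arcs. -/
structure Bounded (s : Layout) (B A : ℕ) : Prop where
  fresh_le : s.fresh ≤ B
  cur_le : s.cur ≤ B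
  pos_le : s.pos ≤ B
  arcs_le : (encodeArcs s.arcs).length ≤ A

lemma Bounded.addPendant {s : Layout} {B A : ℕ} (h : Bounded s B A) :
    Bounded s.addPendant (B + 1) (A + (2 * B + 1)) := by
  obtain ⟨h1, h2, h3, h4⟩ := h
  refine ⟨Nat.succ_le_succ h1, h2.trans (Nat.le_succ B), h3.trans (Nat.le_succ B), ?_⟩
  simp only [Layout.addPendant, encodeArcs_cons, List.length_cons, List.length_append,
    List.length_replicate]
  omega

lemma Bounded.mono {s : Layout} {B A B' A' : ℕ} (h : Bounded s B A) (hB : B ≤ B') (hA : A ≤ A') :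
    Bounded s B' A' :=
  ⟨h.fresh_le.trans hB, h.cur_le.trans hB, h.pos_le.trans hB, h.arcs_le.trans hA⟩

lemma Bounded.addPendant_iterate {s : Layout} {B A D : ℕ} (k : ℕ) (h : Bounded s B A)
    (hD : B + k ≤ D) : Bounded (Layout.addPendant^[k] s) (B + k) (A + k * (2 * D + 1)) := by
  induction k generalizing D with
  | zero => simpa using h
  | succ k ih =>
    rw [Function.iterate_succ_apply']
    refine (ih (D := D) (by omega)).addPendant.mono (by omega) ?_
    have := add_one_mul k (2 * D + 1)
    omega

/-- A symbol adds at most `6` vertices and at most `5` arcs; `D` is a common bound for the ends of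
these arcs. -/
lemma Bounded.step {s : Layout} {B A D : ℕ} (h : Bounded s B A) (hD : B + 6 ≤ D)
    (x : TableSymbol) : Bounded (s.step x) (B + 6) (A + 5 * (2 * D + 1)) := by
  have h0 := h
  obtain ⟨h1, h2, h3, h4⟩ := h
  rcases x with - | κ | (- | -) | - | -
  · exact ⟨by simp only [Layout.step]; omega, by simp only [Layout.step]; omega,
      by simp only [Layout.step]; omega, by simp only [Layout.step]; omega⟩
  · have h5 : Bounded s.newEntry (B + 1) A := by
      refine ⟨?_, ?_, ?_, h4⟩ <;> simp only [Layout.newEntry] <;> omega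
    have hκ := κ.pendants_le
    refine (h5.addPendant_iterate κ.pendants (D := D) (by omega)).mono (by omega) ?_
    have : κ.pendants * (2 * D + 1) ≤ 5 * (2 * D + 1) := Nat.mul_le_mul_right _ hκ
    omega
  · exact ⟨by simp only [Layout.step]; omega, by simp only [Layout.step]; omega,
      by simp only [Layout.step]; omega, by simp only [Layout.step]; omega⟩
  · refine ⟨?_, ?_, ?_, ?_⟩ <;> simp only [Layout.step, encodeArcs_cons, List.length_cons,
      List.length_append, List.length_replicate] <;> omega
  · exact (h0.addPendant_iterate 4 (D := D) (by omega)).mono (by omega) (by omega)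
  · exact h0.mono (by omega) (by omega)

lemma reaches_foldl {s : Layout} {l inp : List TableSymbol} {rev : List GraphSymbol} {B A D : ℕ}
    (hl : .endMark ∉ l) (h : Bounded s B A) (hD : B + 6 * (l.length + 1) ≤ D) :
    Reaches (l.length * (32 * (D + 1))) (cfg .read (contents s (l ++ inp) rev))
        (cfg .read (contents (l.foldl Layout.step s) inp rev)) ∧
      Bounded (l.foldl Layout.step s) (B + 6 * l.length) (A + l.length * (5 * (2 * D + 1))) := by
  induction l generalizing s B A with
  | nil => exact ⟨(Reaches.refl _).mono (by simp), h.mono (by simp) (by simp)⟩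
  | cons x l ih =>
    rw [List.length_cons] at hD ⊢
    have h1 := reaches_step (s := s) (inp := l ++ inp) (rev := rev) (B := D)
      (x := x) (fun hx => hl (by simp [hx])) (by have := h.fresh_le; omega)
      (by have := h.cur_le; omega) (by have := h.pos_le; omega)
    obtain ⟨h2, h3⟩ := ih (fun hx => hl (by simp [hx])) (h.step (D := D) (by omega) x) (by omega)
    refine ⟨(h1.trans h2).mono ?_, h3.mono (by omega) ?_⟩
    · have := add_one_mul l.length (32 * (D + 1)); omega
    · have := add_one_mul l.length (5 * (2 * D + 1)); omega

/-- At an end mark, the machine appends the code of the graph to the (reversed) output. -/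
lemma reaches_endMark {s : Layout} {inp : List TableSymbol} {rev : List GraphSymbol} :
    Reaches (s.fresh + (encodeArcs s.arcs).length + s.cur + s.pos + 6)
      (cfg .read (contents s (.endMark :: inp) rev))
      (cfg .read (contents Layout.initial inp
        (s.encode.reverse ++ rev))) := by
  have h0 : Reaches 2 (cfg .read (contents s (.endMark :: inp) rev))
      (cfg .finishFresh (contents s inp rev)) :=
    reaches_read rfl rfl rfl rfl fun k => by cases k <;> rfl
  have h1 := reaches_loop (l := .finishFresh)
    (fun c a => { contents s inp rev with fresh := c, rev := List.replicate a .vertex ++ rev })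
    (Q := fun a => cfg .finishArcs
      { contents s inp rev with fresh := 0, rev := List.replicate a .vertex ++ rev })
    (fun c a => reaches_of_stepAux rfl rfl fun k => by cases k <;> rfl)
    (fun a => reaches_of_stepAux rfl rfl fun k => by cases k <;> rfl) s.fresh
  have h2 : ∀ l r, Reaches (l.length + 1)
      (cfg .finishArcs { contents s inp r with fresh := 0, arcs := l })
      (cfg .finishCur { contents s inp (.endMark :: (l.reverse ++ r)) with
        fresh := 0, arcs := [] }) := by
    intro l
    induction l with
    | nil => exact fun r => reaches_of_stepAux rfl rfl fun k => by cases k <;> rfl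
    | cons x l ih =>
      intro r
      have h : Reaches 1 (cfg .finishArcs { contents s inp r with fresh := 0, arcs := x :: l })
          (cfg .finishArcs { contents s inp (x :: r) with fresh := 0, arcs := l }) :=
        reaches_of_stepAux rfl rfl fun k => by cases k <;> rfl
      have h' := (h.trans (ih (x :: r))).mono
        (by rw [List.length_cons]; omega : _ ≤ (x :: l).length + 1)
      rwa [List.reverse_cons, List.append_assoc, List.singleton_append]
  generalize hr : s.encode.reverse ++ rev
    = r
  have hr' : r = .endMark :: ((encodeArcs s.arcs).reverse ++
      (List.replicate s.fresh .vertex ++ rev)) := by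
    simp [← hr, Layout.encode]
  have h2' := h2 (encodeArcs s.arcs) (List.replicate s.fresh .vertex ++ rev)
  rw [← hr'] at h2'
  have h3 := reaches_loop (l := .finishCur)
    (fun c _ => { contents s inp r with fresh := 0, arcs := [], cur := c })
    (Q := fun _ => cfg .finishPos { contents s inp r with fresh := 0, arcs := [], cur := 0 })
    (fun c a => reaches_of_stepAux rfl rfl fun k => by cases k <;> rfl)
    (fun a => reaches_of_stepAux rfl rfl fun k => by cases k <;> rfl) s.cur
  have h4 := reaches_loop (l := .finishPos)
    (fun c _ => { contents s inp r with fresh := 0, arcs := [], cur := 0, pos := c })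
    (Q := fun _ => cfg .read (contents Layout.initial inp r))
    (fun c a => reaches_of_stepAux rfl rfl fun k => by cases k <;> rfl)
    (fun a => reaches_of_stepAux rfl rfl fun k => by cases k <;> rfl) s.pos
  exact (((h0.trans h1).trans h2').trans (h3.trans h4)).mono (by omega)

/-- A table of length `N` is processed in `O(N ^ 2)` steps. -/
lemma reaches_table {l inp : List TableSymbol} {rev : List GraphSymbol} (hl : .endMark ∉ l) :
    Reaches (400 * (l.length + 1) ^ 2)
      (cfg .read (contents Layout.initial (l ++ [.endMark] ++ inp) rev))
      (cfg .read (contents Layout.initial inp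
        ((l.foldl Layout.step Layout.initial).encode.reverse ++ rev))) ∧
    (l.foldl Layout.step Layout.initial).encode.length ≤
      100 * (l.length + 1) ^ 2 := by
  have h0 : Bounded Layout.initial 0 0 := ⟨le_rfl, le_rfl, le_rfl, le_rfl⟩
  obtain ⟨h1, h2, h3, h4, h5⟩ := reaches_foldl (inp := .endMark :: inp) (rev := rev) hl h0
    (D := 6 * (l.length + 1)) (by omega)
  have h6 := h1.trans (reaches_endMark (rev := rev))
  constructor
  · rw [List.append_assoc, List.singleton_append]
    refine h6.mono ?_
    nlinarith
  · simp only [Layout.encode, List.length_append, List.length_replicate, List.length_singleton]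
    nlinarith

/-- The machine on an input that consists of two tables. -/
lemma outputsInTime {l l' : List TableSymbol} (hl : .endMark ∉ l) (hl' : .endMark ∉ l') :
    Nonempty (Turing.TM2OutputsInTime machine (l ++ [.endMark] ++ (l' ++ [.endMark]))
      (some ((l.foldl Layout.step Layout.initial).encode ++
        (l'.foldl Layout.step Layout.initial).encode))
      (600 * ((l.length + 1) ^ 2 + (l'.length + 1) ^ 2))) := by
  obtain ⟨h1, b1⟩ := reaches_table (inp := l' ++ [.endMark]) (rev := []) hl
  obtain ⟨h2, b2⟩ := reaches_table (inp := [])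
    (rev := (l.foldl Layout.step Layout.initial).encode.reverse ++ []) hl'
  rw [List.append_nil (l' ++ [TableSymbol.endMark])] at h2
  generalize (l.foldl Layout.step Layout.initial).encode = w at *
  generalize (l'.foldl Layout.step Layout.initial).encode = w' at *
  have h3 : ∀ r, Reaches 2 (cfg .read (contents Layout.initial [] r))
      (cfg .reverse (contents Layout.initial [] r)) :=
    fun r => reaches_read rfl rfl rfl rfl fun k => by cases k <;> rfl
  have h4 : ∀ r o, Reaches (r.length + 1)
      (cfg .reverse { contents Layout.initial [] r with output := o })
      (Turing.haltList machine (r.reverse ++ o)) := by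
    intro r
    induction r with
    | nil =>
      exact fun o => reaches_of_step (congrArg some (congrArg (Turing.TM2.Cfg.mk none blank)
        (funext fun k => by cases k <;> rfl)))
    | cons x r ih =>
      intro o
      have h : Reaches 1 (cfg .reverse { contents Layout.initial [] (x :: r) with output := o })
          (cfg .reverse { contents Layout.initial [] r with output := x :: o }) :=
        reaches_of_stepAux rfl rfl fun k => by cases k <;> rfl
      have h' := (h.trans (ih (x :: o))).mono
        (by rw [List.length_cons]; omega : _ ≤ (x :: r).length + 1)
      rwa [List.reverse_cons, List.append_assoc]
  have h5 := (h1.trans h2).trans ((h3 _).trans (h4 _ []))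
  have hi : Turing.initList machine (l ++ [.endMark] ++ (l' ++ [.endMark])) =
      cfg .read (contents Layout.initial (l ++ [.endMark] ++ (l' ++ [.endMark])) []) :=
    congrArg (Turing.TM2.Cfg.mk (some Label.read) blank) (funext fun k => by cases k <;> rfl)
  have ho : (w'.reverse ++ (w.reverse ++ [])).reverse ++ [] = w ++ w' := by simp
  rw [ho] at h5
  rw [Turing.TM2OutputsInTime, hi]
  refine h5.mono ?_
  simp only [List.length_append, List.length_reverse, List.length_nil]
  have := Nat.one_le_pow 2 (l.length + 1) (by omega)
  omega

end GraphMachine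

/-! ### The reductions -/

lemma endMark_notMem_symbols {n : ℕ} (T : LockedTable n) : .endMark ∉ T.symbols := by
  simp [LockedTable.symbols, encodeEntry]

lemma length_encodeEntry {n : ℕ} (κ : SetKind) (X : Finset (Fin n) × ℕ) :
    (encodeEntry κ X).length = n + X.2 + 1 := by
  simp [encodeEntry]

lemma LockedTable.Represents.length_symbols_le {n : ℕ} {T : LockedTable n} {M : Matroid (Fin n)}
    (h : T.Represents M) :
    T.symbols.length ≤ n + (3 * n + M.lockedNumber) * (2 * n + 1) := by
  rw [symbols, List.length_append, List.length_replicate, List.length_flatMap]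
  refine Nat.add_le_add_left ((List.sum_le_card_nsmul _ (2 * n + 1) ?_).trans ?_) n
  · intro m hm
    obtain ⟨x, hx, rfl⟩ := List.mem_map.1 hm
    rw [length_encodeEntry]
    have := h.rank_le hx
    omega
  · rw [List.length_map, smul_eq_mul]
    exact Nat.mul_le_mul_right _ h.length_entryList_le

/-- The computation of the graphs in polynomial time. -/
lemma exists_polynomial_outputsInTime {k : ℕ} {C : Set FiniteMatroid} (hC : IsLockedClass k C) :
    ∃ p : Polynomial ℕ, ∀ x : GivenMatroid C × GivenMatroid C,
      Nonempty (Turing.TM2OutputsInTime GraphMachine.machine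
        (x.1.table.encode ++ x.2.table.encode) (some (x.1.graph.encode ++ x.2.graph.encode))
        (p.eval (x.1.M.n + x.2.M.n))) := by
  obtain ⟨c, hc⟩ := hC
  let q : Polynomial ℕ := .X + (3 * .X + .C c * .X ^ k) * (2 * .X + 1) + 1
  refine ⟨1200 * q ^ 2, fun x => ?_⟩
  have hq : ∀ (y : GivenMatroid C) (s : ℕ), y.M.n ≤ s →
      y.table.symbols.length + 1 ≤ q.eval s := by
    intro y s hs
    have h1 := y.represents.length_symbols_le
    have h2 := (hc y.M y.mem).trans (Nat.mul_le_mul_left c (Nat.pow_le_pow_left hs k))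
    simp only [q, Polynomial.eval_add, Polynomial.eval_mul, Polynomial.eval_X, Polynomial.eval_C,
      Polynomial.eval_pow, Polynomial.eval_one, Polynomial.eval_ofNat]
    refine Nat.succ_le_succ (h1.trans (Nat.add_le_add hs (Nat.mul_le_mul ?_ ?_))) <;> omega
  have h1 := GraphMachine.outputsInTime (endMark_notMem_symbols x.1.table)
    (endMark_notMem_symbols x.2.table)
  rw [x.1.table.encode_eq, x.2.table.encode_eq, x.1.encode_graph, x.2.encode_graph]
  refine h1.map fun h => ⟨h.toEvalsTo, h.steps_le_m.trans ?_⟩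
  have h2 := Nat.pow_le_pow_left (hq x.1 _ (Nat.le_add_right x.1.M.n x.2.M.n)) 2
  have h3 := Nat.pow_le_pow_left (hq x.2 _ (Nat.le_add_left x.2.M.n x.1.M.n)) 2
  simp only [Polynomial.eval_mul, Polynomial.eval_pow, Polynomial.eval_ofNat]
  omega

theorem theorem3p3 (k : ℕ) (C : Set FiniteMatroid) (hC : IsLockedClass k C) :
    PolyTimeReducible (matroidIsomorphism C) acyclicDigraphIsomorphism ∧
      PolyTimeReducible (matroidIsomorphism C) graphIsomorphism := by
  obtain ⟨p, hp⟩ := exists_polynomial_outputsInTime hC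
  have hmap : ∀ {α : Type} (l : List α), l.map (Equiv.refl α).symm = l := fun l => by simp
  constructor
  · refine ⟨fun x => (⟨x.1.graph, x.1.graph_isAcyclic⟩, ⟨x.2.graph, x.2.graph_isAcyclic⟩),
      ⟨GraphMachine.machine, Equiv.refl TableSymbol, Equiv.refl GraphSymbol⟩, p, fun x => ?_,
      fun x => (x.1.isomorphic_iff x.2).1⟩
    have h := hp x
    rw [← hmap (_ ++ _), ← hmap (x.1.graph.encode ++ _)] at h
    exact h
  · refine ⟨fun x => (x.1.graph, x.2.graph),
      ⟨GraphMachine.machine, Equiv.refl TableSymbol, Equiv.refl GraphSymbol⟩, p, fun x => ?_,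
      fun x => (x.1.isomorphic_iff x.2).2⟩
    have h := hp x
    rw [← hmap (_ ++ _), ← hmap (x.1.graph.encode ++ _)] at h
    exact h
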